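/- Let $M$ be a von Neumann algebra on a complex Hilbert space $\mathcal H$ with a semifinite trace $\tau$ on its positive part (additive, positively homogeneous, invariant under unitary conjugation in $M$, with values in $[0,\infty]$, and such that $\tau(a)=\sup\{\tau(b): b\in M,\ 0\le b\le a,\ \tau(b)<\infty\}$ for all $a\in M_+$). Let $L$ be a closed, densely defined (possibly unbounded) operator on $\mathcal H$ affiliated with $M$ (that is, $VL\subseteq LV$ for all $V$ in the commutant of $M$), let $|L|=(L^*L)^{1/2}$, and let $E_B(|L|)$ denote the spectral projection of $|L|$ for the Borel set $B\subseteq[0,\infty)$. For a $\tau$-measurable operator $T$ and $1\le r<\infty$ put $$\|T\|_{L^{r,\infty}(M)}=\sup_{t>0}t^{1/r}\mu_t(T),\qquad \mu_t(T)=\inf\{\gamma\ge 0:\ \tau(E_{(\gamma,\infty)}(|T|))\le t\}.$$ Let $\varphi:[0,\infty)\to\mathbb C$ be Borel measurable and let $\psi:[0,\infty)\to\mathbb R$ be continuous and monotonically decreasing with $\psi(0)=1$, $\lim_{v\to\infty}\psi(v)=0$ and $|\varphi(v)|\le\psi(v)$ for all $v\ge 0$. Then, for every $1\le r<\infty$,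 the operator $\varphi(|L|)$ is $\tau$-measurable and (in $[0,\infty]$, with $0\cdot\infty=0$) $$\|\varphi(|L|)\|_{L^{r,\infty}(M)}\le\sup_{v>0}\psi(v)\,\big[\tau(E_{[0,v)}(|L|))\big]^{1/r}.$$ If moreover $\ker L=\{0\}$ or $\varphi(0)=0$, then also $$\|\varphi(|L|)\|_{L^{r,\infty}(M)}\le\sup_{v>0}\psi(v)\,\big[\tau(E_{(0,v)}(|L|))\big]^{1/r}.$$ -/

import Mathlib

open scoped NNReal ENNReal InnerProductSpace
open MeasureTheory Filter Topology

noncomputable section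

namespace NCLorentz

/-! ### Projection-valued measures -/

/-- A projection-valued measure on a measurable space `α`, acting on the Hilbert space `H`:
orthogonal projections, normalised, and countably additive in the strong operator topology. Only
the values on measurable sets matter. -/
structure ProjectionValuedMeasure (α : Type*) [MeasurableSpace α] (H : Type*)
    [NormedAddCommGroup H] [InnerProductSpace ℂ H] [CompleteSpace H] where
  proj : Set α → H →L[ℂ] H
  isStarProjection_proj : ∀ s, MeasurableSet s → IsStarProjection (proj s)
  proj_univ : proj Set.univ = 1
  hasSum_proj_iUnion : ∀ s : ℕ → Set α, (∀ i, MeasurableSet (s i)) →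
    Pairwise (Function.onFun Disjoint s) →
    ∀ x : H, HasSum (fun i => proj (s i) x) (proj (⋃ i, s i) x)

section

variable {α : Type*} [MeasurableSpace α] {H : Type*}
  [NormedAddCommGroup H] [InnerProductSpace ℂ H] [CompleteSpace H]

theorem ProjectionValuedMeasure.proj_empty (E : ProjectionValuedMeasure α H) (x : H) :
    E.proj ∅ x = 0 := by
  have h := E.hasSum_proj_iUnion (fun _ => ∅) (fun _ => MeasurableSet.empty)
    (fun i j _ => disjoint_bot_left) x
  exact (summable_const_iff _).1 h.summable

theorem ProjectionValuedMeasure.inner_proj_nonneg (E : ProjectionValuedMeasure α H) (x : H)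
    (s : Set α) (hs : MeasurableSet s) : 0 ≤ (⟪x, E.proj s x⟫_ℂ).re := by
  have h := (ContinuousLinearMap.IsPositive.of_isStarProjection
    (E.isStarProjection_proj s hs)).re_inner_nonneg_right x
  simpa using h

/-- The finite positive measure `E_x = ⟨x, E(·) x⟩`. -/
def ProjectionValuedMeasure.scalarMeasure (E : ProjectionValuedMeasure α H) (x : H) :
    Measure α :=
  Measure.ofMeasurable (fun s _ => ENNReal.ofReal (⟪x, E.proj s x⟫_ℂ).re)
    (by simp [E.proj_empty])
    (by
      intro s hs hd
      have h := E.hasSum_proj_iUnion s hs hd x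
      have h2 : HasSum (fun i => (⟪x, E.proj (s i) x⟫_ℂ).re)
          (⟪x, E.proj (⋃ i, s i) x⟫_ℂ).re :=
        Complex.hasSum_re (h.mapL (innerSL ℂ x))
      simp only [← h2.tsum_eq]
      exact ENNReal.ofReal_tsum_of_nonneg (fun i => E.inner_proj_nonneg x _ (hs i)) h2.summable)

/-- `T = ∫ f dE`: the domain of `T` consists of the `x` with `∫ |f|² dE_x < ∞`, and
`⟨x, T x⟩ = ∫ f dE_x` there. By polarisation and density of the domain, at most one operator `T`
has this property. -/
def ProjectionValuedMeasure.IsIntegral (E : ProjectionValuedMeasure α H) (f : α → ℂ)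
    (T : H →ₗ.[ℂ] H) : Prop :=
  (∀ x : H, x ∈ T.domain ↔ MemLp f 2 (E.scalarMeasure x)) ∧
    ∀ x : T.domain, ⟪(x : H), T x⟫_ℂ = ∫ a, f a ∂(E.scalarMeasure (x : H))

open Classical in
/-- The (possibly unbounded) operator `∫ f dE`, which exists for every measurable `f`. -/
def ProjectionValuedMeasure.integral (E : ProjectionValuedMeasure α H) (f : α → ℂ) :
    H →ₗ.[ℂ] H :=
  if h : ∃ T : H →ₗ.[ℂ] H, E.IsIntegral f T then h.choose else ⊥

open Classical in
/-- The projection-valued measure concentrated at the point `a`. -/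
def ProjectionValuedMeasure.dirac (H : Type*) [NormedAddCommGroup H] [InnerProductSpace ℂ H]
    [CompleteSpace H] (a : α) : ProjectionValuedMeasure α H where
  proj s := if a ∈ s then 1 else 0
  isStarProjection_proj s _ := by
    split_ifs
    · exact IsStarProjection.one _
    · exact IsStarProjection.zero _
  proj_univ := by simp
  hasSum_proj_iUnion s _ hd x := by
    by_cases h : ∃ i, a ∈ s i
    · obtain ⟨i, hi⟩ := h
      have hU : a ∈ ⋃ i, s i := Set.mem_iUnion.2 ⟨i, hi⟩
      have := hasSum_single (f := fun j => (if a ∈ s j then (1 : H →L[ℂ] H) else 0) x) i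
        (fun j hj => by
          have : a ∉ s j := fun hj' => (Set.disjoint_left.1 (hd hj)) hj' hi
          simp [this])
      simpa [hi, hU] using this
    · have hU : a ∉ ⋃ i, s i := fun hU => h (Set.mem_iUnion.1 hU)
      have h' : ∀ i, a ∉ s i := fun i hi => h ⟨i, hi⟩
      simp [hU, h', hasSum_zero]

end

/-! ### Borel functional calculus of positive self-adjoint operators, and the modulus -/

section

variable {H : Type*} [NormedAddCommGroup H] [InnerProductSpace ℂ H] [CompleteSpace H]

/-- `E` is the spectral measure of the positive self-adjoint operator `A`: `A = ∫ λ dE(λ)`. -/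
def IsSpectralMeasure (A : H →ₗ.[ℂ] H) (E : ProjectionValuedMeasure ℝ≥0 H) : Prop :=
  E.IsIntegral (fun t : ℝ≥0 => ((t : ℝ) : ℂ)) A

open Classical in
/-- The spectral measure on `[0, ∞)` of a positive self-adjoint operator `A`, which exists and is
unique by the spectral theorem. The value for other operators `A` is a dummy. -/
def spectralMeasure (A : H →ₗ.[ℂ] H) : ProjectionValuedMeasure ℝ≥0 H :=
  if h : ∃ E, IsSpectralMeasure A E then h.choose else ProjectionValuedMeasure.dirac H 1

/-- The spectral projection `E_B(A)` of the positive self-adjoint operator `A`. -/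
def spectralProj (A : H →ₗ.[ℂ] H) (B : Set ℝ≥0) : H →L[ℂ] H :=
  (spectralMeasure A).proj B

/-- The operator `f(A) = ∫ f(λ) dE_λ(A)`, for `A` positive self-adjoint and `f` Borel on
`[0, ∞)`. -/
def borelCalc (A : H →ₗ.[ℂ] H) (f : ℝ≥0 → ℂ) : H →ₗ.[ℂ] H :=
  (spectralMeasure A).integral f

/-- The composition `S ∘ T` of unbounded operators, with domain
`{x ∈ D(T) | T x ∈ D(S)}`. -/
def compOp (S T : H →ₗ.[ℂ] H) : H →ₗ.[ℂ] H :=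
  S.comp (T.domRestrict ((S.domain.comap T.toFun).map T.domain.subtype)) (by
    intro x
    obtain ⟨y, hy, hyx⟩ := x.2.1
    have h : T.domRestrict _ x = T y := LinearPMap.domRestrict_apply hyx.symm
    rw [h]
    exact hy)

/-- The modulus `|L| = (L* L)^{1/2}` of a closed densely defined operator `L`. -/
def modulus (L : H →ₗ.[ℂ] H) : H →ₗ.[ℂ] H :=
  borelCalc (compOp L.adjoint L) (fun t => ((NNReal.sqrt t : ℝ) : ℂ))

/-! ### Von Neumann algebras, traces, weak Lorentz norms -/

/-- `L` is affiliated with `M`: it commutes with every `V` in the commutant of `M`, in the usual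
sense `V L ⊆ L V` for an operator `L` that need not be everywhere defined. -/
def IsAffiliated (M : VonNeumannAlgebra H) (L : H →ₗ.[ℂ] H) : Prop :=
  ∀ V ∈ M.commutant, ∀ x : L.domain, ∃ h : V x ∈ L.domain, L ⟨V x, h⟩ = V (L x)

/-- A trace on the positive part of the von Neumann algebra `M`. Only the values of `toFun` on
positive elements of `M` matter. -/
structure Trace (M : VonNeumannAlgebra H) where
  toFun : (H →L[ℂ] H) → ℝ≥0∞
  map_add : ∀ a ∈ M, ∀ b ∈ M, a.IsPositive → b.IsPositive → toFun (a + b) = toFun a + toFun b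
  map_smul : ∀ (c : ℝ≥0), ∀ a ∈ M, a.IsPositive → toFun (((c : ℝ) : ℂ) • a) = c * toFun a
  map_unitary_conj : ∀ a ∈ M, a.IsPositive → ∀ u ∈ M, u ∈ unitary (H →L[ℂ] H) →
    toFun (u * a * star u) = toFun a

variable {M : VonNeumannAlgebra H}

/-- The trace is semifinite: the trace of a positive element is the supremum of the finite traces
of the positive elements below it. -/
def Trace.IsSemifinite (τ : Trace M) : Prop :=
  ∀ a ∈ M, a.IsPositive →
    IsLUB {c : ℝ≥0∞ | ∃ b ∈ M, b.IsPositive ∧ (a - b).IsPositive ∧ τ.toFun b < ∞ ∧ τ.toFun b = c}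
      (τ.toFun a)

/-- `T` is `τ`-measurable, `T ∈ S(M)`. -/
def Trace.IsMeasurableOp (τ : Trace M) (T : H →ₗ.[ℂ] H) : Prop :=
  T.IsClosed ∧ Dense (T.domain : Set H) ∧ IsAffiliated M T ∧
    ∀ ε : ℝ≥0, 0 < ε → ∃ P ∈ M, IsStarProjection P ∧ (∀ x, P x ∈ T.domain) ∧
      τ.toFun (1 - P) ≤ ε

/-- The distribution function `d_γ(T) = τ(E_{(γ,∞)}(|T|))`. -/
def Trace.distribution (τ : Trace M) (T : H →ₗ.[ℂ] H) (γ : ℝ≥0) : ℝ≥0∞ :=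
  τ.toFun (spectralProj (modulus T) (Set.Ioi γ))

/-- The generalized singular numbers `μ_t(T) = inf {γ ≥ 0 | d_γ(T) ≤ t}`, with `inf ∅ = ∞`. -/
def Trace.singularNumber (τ : Trace M) (T : H →ₗ.[ℂ] H) (t : ℝ≥0) : ℝ≥0∞ :=
  ⨅ (γ : ℝ≥0) (_ : τ.distribution T γ ≤ t), (γ : ℝ≥0∞)

/-- The weak Lorentz norm `‖T‖_{L^{r,∞}(M)} = sup_{t > 0} t^{1/r} μ_t(T)`. -/
def Trace.weakLorentzNorm (τ : Trace M) (r : ℝ) (T : H →ₗ.[ℂ] H) : ℝ≥0∞ :=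
  ⨆ (t : ℝ≥0) (_ : 0 < t), (t : ℝ≥0∞) ^ (1 / r) * τ.singularNumber T t

end

end NCLorentz

end

/-!
The distribution function of `φ(|L|)` is read off from the spectral measure of `|L|`: the spectral
measure of `|φ(|L|)|` is the image under `|φ|` of that of `|L|`, so that
`d_γ(φ(|L|)) = τ(E_{|φ| > γ}(|L|))`. The superlevel set `{|φ| > γ}` lies in `{ψ > γ}`, which by
continuity and monotonicity is contained in `[0, v)` for some `v` with `ψ v = γ`. If `t < d_γ`,
then `t^{1/r} γ ≤ ψ v · τ(E_{[0, v)}(|L|))^{1/r}`, and taking the supremum over `γ < μ_t` and over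
`t` gives the estimate. If `φ 0 = 0` the superlevel set omits `0`, and if `L` is injective then
`E_{{0}}(|L|) = 0`, so `[0, v)` can be replaced by `(0, v)`. Since `φ` is bounded, so is `φ(|L|)`,
and it is `τ`-measurable because it commutes with the commutant of `M`.

The identification of `|φ(|L|)|` rests on the spectral theorem for `L* L`, which is proved here.

* `IsBoundedClass.of_continuous`, a monotone class theorem, and
  `exists_clm_of_tendsto_inner_self`, on weak limits of operators, extend functional calculi from
  continuous to bounded Borel functions.
* `exists_pvm_of_spectrum_subset` is the spectral theorem for a self-adjoint operator `R` with
  spectrum in `[0, 1]`: the Riesz–Markov–Kakutani theorem represents the forms `⟪x, f(R) x⟫`,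
  with `f` continuous, by measures, and these assemble to a projection-valued measure.
* `exists_isResolvent_adjoint_comp` obtains `R = (1 + L* L)⁻¹` from the orthogonal projection onto
  the graph of `L`; moving the spectral measure of `R` along `s ↦ 1 / s - 1` gives that of `L* L`.
* `ProjectionValuedMeasure.exists_isIntegral_tendsto` and
  `ProjectionValuedMeasure.IsIntegral.unique` say that the integrals `∫ f dE` exist and are
  unique.
* `IsSpectralMeasure.intertwine` says that `V A ⊆ B V` implies `V E_s(A) = E_s(B) V`. With `V = 1`
  it is the uniqueness of the spectral measure, and with `A = B = L* L` it shows that the spectral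
  projections of `|L|` lie in `M` when `L` is affiliated with `M`.
-/

noncomputable section

namespace NCLorentz

/-! ### Bounded measurable functions and their monotone class theorem -/

section

variable {α : Type*} [MeasurableSpace α]

/-- Measurable complex functions with a bound that holds everywhere. Almost everywhere would not
do, because the measures `μ_x` for varying vectors `x` need not have the same null sets. -/
structure IsBddMeas (f : α → ℂ) : Prop where
  measurable : Measurable f
  bdd : ∃ c : ℝ, ∀ x, ‖f x‖ ≤ c

namespace IsBddMeas

variable {f g : α → ℂ}

theorem add (hf : IsBddMeas f) (hg : IsBddMeas g) : IsBddMeas (f + g) := by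
  obtain ⟨c, hc⟩ := hf.bdd
  obtain ⟨d, hd⟩ := hg.bdd
  exact ⟨hf.measurable.add hg.measurable, c + d, fun x =>
    (norm_add_le _ _).trans (add_le_add (hc x) (hd x))⟩

theorem smul (a : ℂ) (hf : IsBddMeas f) : IsBddMeas (a • f) := by
  obtain ⟨c, hc⟩ := hf.bdd
  exact ⟨hf.measurable.const_smul a, ‖a‖ * c, fun x => by
    simpa using mul_le_mul_of_nonneg_left (hc x) (norm_nonneg a)⟩

theorem mul (hf : IsBddMeas f) (hg : IsBddMeas g) : IsBddMeas (f * g) := by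
  obtain ⟨c, hc⟩ := hf.bdd
  obtain ⟨d, hd⟩ := hg.bdd
  refine ⟨hf.measurable.mul hg.measurable, c * d, fun x => ?_⟩
  rw [Pi.mul_apply, norm_mul]
  exact mul_le_mul (hc x) (hd x) (norm_nonneg _) ((norm_nonneg _).trans (hc x))

theorem sub (hf : IsBddMeas f) (hg : IsBddMeas g) : IsBddMeas (f - g) := by
  have := hf.add (hg.smul (-1))
  simpa [sub_eq_add_neg] using this

theorem star (hf : IsBddMeas f) : IsBddMeas (star f) := by
  obtain ⟨c, hc⟩ := hf.bdd
  exact ⟨continuous_star.measurable.comp hf.measurable, c, fun x => by simpa using hc x⟩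

theorem indicator_one {s : Set α} (hs : MeasurableSet s) :
    IsBddMeas (s.indicator (1 : α → ℂ)) :=
  ⟨measurable_one.indicator hs, 1, fun x => by
    by_cases h : x ∈ s <;> simp [h]⟩

theorem one : IsBddMeas (1 : α → ℂ) := ⟨measurable_one, 1, fun x => by simp⟩

theorem of_tendsto {F : ℕ → α → ℂ} {c : ℝ} (hF : ∀ n, Measurable (F n))
    (hc : ∀ n x, ‖F n x‖ ≤ c) (h : ∀ x, Tendsto (fun n => F n x) atTop (𝓝 (f x))) :
    IsBddMeas f :=
  ⟨measurable_of_tendsto_metrizable hF (tendsto_pi_nhds.2 h), c, fun x =>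
    le_of_tendsto (h x).norm (Eventually.of_forall fun n => hc n x)⟩

theorem integrable (hf : IsBddMeas f) (μ : Measure α) [IsFiniteMeasure μ] : Integrable f μ := by
  obtain ⟨c, hc⟩ := hf.bdd
  exact Integrable.of_bound hf.measurable.aestronglyMeasurable c (Eventually.of_forall hc)

end IsBddMeas

/-- A class of functions whose bounded measurable members form a complex vector space that is
stable under bounded pointwise limits of sequences. -/
structure IsBoundedClass (C : (α → ℂ) → Prop) : Prop where
  add : ∀ f g, IsBddMeas f → IsBddMeas g → C f → C g → C (f + g)
  smul : ∀ (a : ℂ) f, IsBddMeas f → C f → C (a • f)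
  lim : ∀ (F : ℕ → α → ℂ) (f : α → ℂ) (c : ℝ), (∀ n, Measurable (F n)) →
    (∀ n x, ‖F n x‖ ≤ c) → (∀ x, Tendsto (fun n => F n x) atTop (𝓝 (f x))) →
    (∀ n, C (F n)) → C f

/-- A bounded class that contains the indicators of measurable sets contains every bounded
measurable function. -/
theorem IsBoundedClass.of_indicator {C : (α → ℂ) → Prop} (hC : IsBoundedClass C)
    (hi : ∀ s, MeasurableSet s → C (s.indicator 1)) {f : α → ℂ} (hf : IsBddMeas f) : C f := by
  have hsimple : ∀ g : SimpleFunc α ℂ, C g := by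
    intro g
    induction g using SimpleFunc.induction with
    | const c hs =>
      rename_i s
      have := hC.smul c _ (IsBddMeas.indicator_one hs) (hi s hs)
      convert this using 1
      ext x
      by_cases hx : x ∈ s <;> simp [hx]
    | add _ h1 h2 =>
      rename_i f g _
      have hb : ∀ f : SimpleFunc α ℂ, IsBddMeas f := fun f =>
        ⟨f.measurable, f.exists_forall_norm_le⟩
      exact hC.add _ _ (hb f) (hb g) h1 h2
  obtain ⟨c, hc⟩ := hf.bdd
  have hsm := hf.measurable.stronglyMeasurable
  by_cases hα : Nonempty α
  · have hc0 : 0 ≤ c := (norm_nonneg _).trans (hc hα.some)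
    exact hC.lim (fun n => hsm.approxBounded c n) f c (fun n => SimpleFunc.measurable _)
      (fun n x => hsm.norm_approxBounded_le hc0 n x)
      (fun x => hsm.tendsto_approxBounded_of_norm_le (hc x)) (fun n => hsimple _)
  · have : f = (0 : SimpleFunc α ℂ) := funext fun x => (hα ⟨x⟩).elim
    rw [this]
    exact hsimple 0

/-- The monotone class theorem for a metric space: a bounded class that contains the
continuous functions with values in `[0, 1]` contains every bounded Borel function. The indicators
of closed sets are limits of such functions, and Dynkin's π-λ theorem gives those of Borel sets. -/
theorem IsBoundedClass.of_continuous {α : Type*} [PseudoMetricSpace α] [MeasurableSpace α]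
    [BorelSpace α] {C : (α → ℂ) → Prop} (hC : IsBoundedClass C)
    (hi : ∀ f : α → ℝ, Continuous f → (∀ x, 0 ≤ f x ∧ f x ≤ 1) → C (fun x => (f x : ℂ)))
    {f : α → ℂ} (hf : IsBddMeas f) : C f := by
  refine hC.of_indicator (fun s hs => ?_) hf
  have h1 : C 1 := by
    have := hi (fun _ => 1) continuous_const (by simp)
    simp only [Complex.ofReal_one] at this
    exact this
  have hgen : ‹MeasurableSpace α› = MeasurableSpace.generateFrom {s : Set α | IsClosed s} :=
    BorelSpace.measurable_eq.trans borel_eq_generateFrom_isClosed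
  induction s, hs using MeasurableSpace.induction_on_inter hgen isPiSystem_isClosed with
  | empty =>
    have := hC.smul 0 1 IsBddMeas.one h1
    rw [zero_smul] at this
    rw [Set.indicator_empty]
    exact this
  | basic t ht =>
    have ht : IsClosed t := ht
    have hpos : ∀ n : ℕ, (0 : ℝ) < 1 / ((n : ℝ) + 1) := fun n => by positivity
    have hlim := tendsto_pi_nhds.1 (thickenedIndicator_tendsto_indicator_closure hpos
      tendsto_one_div_add_atTop_nhds_zero_nat t)
    rw [ht.closure_eq] at hlim
    have hcont : ∀ n, Continuous fun x => ((thickenedIndicator (hpos n) t x : ℝ≥0) : ℝ) :=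
      fun n => NNReal.continuous_coe.comp (thickenedIndicator (hpos n) t).continuous
    have hle : ∀ n x, ((thickenedIndicator (hpos n) t x : ℝ≥0) : ℝ) ≤ 1 := fun n x => by
      exact_mod_cast thickenedIndicator_le_one (hpos n) t x
    refine hC.lim (fun n x => (((thickenedIndicator (hpos n) t x : ℝ≥0) : ℝ) : ℂ)) _ 1
      (fun n => (Complex.continuous_ofReal.comp (hcont n)).measurable) (fun n x => ?_)
      (fun x => ?_) (fun n => hi _ (hcont n) fun x => ⟨NNReal.coe_nonneg _, hle n x⟩)
    · rw [Complex.norm_real, Real.norm_of_nonneg (NNReal.coe_nonneg _)]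
      exact hle n x
    · have h := (Complex.continuous_ofReal.comp NNReal.continuous_coe).tendsto _ |>.comp (hlim x)
      have he : t.indicator (1 : α → ℂ) x =
          (Complex.ofReal ∘ NNReal.toReal) (t.indicator (fun _ => 1) x) := by
        by_cases hx : x ∈ t <;> simp [hx]
      rw [he]
      exact h
  | compl t ht h =>
    have := hC.add _ _ IsBddMeas.one ((IsBddMeas.indicator_one ht).smul (-1)) h1
      (hC.smul (-1) _ (IsBddMeas.indicator_one ht) h)
    convert this using 1
    ext x
    by_cases hx : x ∈ t <;> simp [hx]
  | iUnion s hd hs h =>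
    have hm : ∀ n, MeasurableSet (⋃ i ∈ Finset.range n, s i) := fun n =>
      Finset.measurableSet_biUnion _ fun i _ => hs i
    refine hC.lim (fun n => (⋃ i ∈ Finset.range n, s i).indicator 1) _ 1
      (fun n => (IsBddMeas.indicator_one (hm n)).measurable) (fun n x => ?_) (fun x => ?_)
      (fun n => ?_)
    · by_cases hx : x ∈ ⋃ i ∈ Finset.range n, s i
      · rw [Set.indicator_of_mem hx]; simp
      · rw [Set.indicator_of_notMem hx]; simp
    · exact ((tendsto_indicator_biUnion_finset s 1 x).comp tendsto_finset_range).mono_right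
        (pure_le_nhds _)
    · induction n with
      | zero =>
        have := hC.smul 0 1 IsBddMeas.one h1
        rw [zero_smul] at this
        simp only [Finset.range_zero, Finset.notMem_empty, Set.iUnion_of_empty,
          Set.iUnion_empty, Set.indicator_empty]
        exact this
      | succ n ih =>
        have hdis : Disjoint (⋃ i ∈ Finset.range n, s i) (s n) := by
          simp only [Set.disjoint_iUnion_left, Finset.mem_range]
          exact fun i hi => hd hi.ne
        have := hC.add _ _ (IsBddMeas.indicator_one (hm n)) (IsBddMeas.indicator_one (hs n)) ih
          (h n)
        have hun : (⋃ i ∈ Finset.range n, s i).indicator (1 : α → ℂ) + (s n).indicator 1 =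
            ((⋃ i ∈ Finset.range n, s i) ∪ s n).indicator 1 :=
          (Set.indicator_union_of_disjoint hdis _).symm
        rw [hun] at this
        convert this using 2
        ext x
        simp only [Finset.mem_range, Set.mem_iUnion, exists_prop, Set.mem_union,
          Nat.lt_succ_iff_lt_or_eq]
        constructor
        · rintro ⟨i, hi | rfl, hx⟩
          · exact Or.inl ⟨i, hi, hx⟩
          · exact Or.inr hx
        · rintro (⟨i, hi, hx⟩ | hx)
          · exact ⟨i, Or.inl hi, hx⟩
          · exact ⟨n, Or.inr rfl, hx⟩

end

/-! ### Weak limits of operators -/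

section

variable {H : Type*} [NormedAddCommGroup H] [InnerProductSpace ℂ H]

/-- Polarisation of the sesquilinear form `(x, y) ↦ ⟪ι x, T y⟫`; with `ι` the inclusion of the
domain, this covers unbounded operators. -/
theorem inner_polarization_comp {V : Type*} [AddCommGroup V] [Module ℂ V] (ι T : V →ₗ[ℂ] H)
    (x y : V) :
    ⟪ι x, T y⟫_ℂ = (⟪ι (x + y), T (x + y)⟫_ℂ - ⟪ι (x - y), T (x - y)⟫_ℂ
      - Complex.I * ⟪ι (x + Complex.I • y), T (x + Complex.I • y)⟫_ℂ
      + Complex.I * ⟪ι (x - Complex.I • y), T (x - Complex.I • y)⟫_ℂ) / 4 := by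
  simp only [map_add, map_sub, inner_add_left, inner_add_right, inner_sub_left, inner_sub_right,
    map_smul, inner_smul_left, inner_smul_right, Complex.conj_I]
  linear_combination ((1 / 2 : ℂ) * (-⟪ι y, T x⟫_ℂ + ⟪ι x, T y⟫_ℂ)) * Complex.I_sq

theorem inner_polarization (T : H →L[ℂ] H) (x y : H) :
    ⟪x, T y⟫_ℂ = (⟪x + y, T (x + y)⟫_ℂ - ⟪x - y, T (x - y)⟫_ℂ
      - Complex.I * ⟪x + Complex.I • y, T (x + Complex.I • y)⟫_ℂ
      + Complex.I * ⟪x - Complex.I • y, T (x - Complex.I • y)⟫_ℂ) / 4 :=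
  inner_polarization_comp LinearMap.id (T : H →ₗ[ℂ] H) x y

theorem ext_of_inner_self {S T : H →L[ℂ] H} (h : ∀ x, ⟪x, S x⟫_ℂ = ⟪x, T x⟫_ℂ) : S = T := by
  ext y
  refine ext_inner_left ℂ fun x => ?_
  rw [inner_polarization S, inner_polarization T, h, h, h, h]

theorem tendsto_inner_of_tendsto_inner_self {T : ℕ → H →L[ℂ] H} {q : H → ℂ}
    (h : ∀ x, Tendsto (fun n => ⟪x, T n x⟫_ℂ) atTop (𝓝 (q x))) (x y : H) :
    Tendsto (fun n => ⟪x, T n y⟫_ℂ) atTop (𝓝 ((q (x + y) - q (x - y)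
      - Complex.I * q (x + Complex.I • y) + Complex.I * q (x - Complex.I • y)) / 4)) := by
  simp_rw [fun n => inner_polarization (T n) x y]
  exact ((((h _).sub (h _)).sub ((h _).const_mul _)).add ((h _).const_mul _)).div_const _

/-- A bound on the numerical range of an operator bounds its sesquilinear form, by polarisation. -/
theorem norm_inner_le_of_inner_self_le {T : H →L[ℂ] H} {C : ℝ} (hC : 0 ≤ C)
    (h : ∀ x, ‖⟪x, T x⟫_ℂ‖ ≤ C * ‖x‖ ^ 2) (x y : H) : ‖⟪x, T y⟫_ℂ‖ ≤ 4 * C * ‖x‖ * ‖y‖ := by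
  have key : ∀ x y : H, ‖x‖ = 1 → ‖y‖ = 1 → ‖⟪x, T y⟫_ℂ‖ ≤ 4 * C := by
    intro x y hx hy
    have hI : ‖Complex.I • y‖ = 1 := by rw [norm_smul, Complex.norm_I, hy, one_mul]
    have hb : ∀ z, ‖z‖ ≤ 2 → ‖⟪z, T z⟫_ℂ‖ ≤ C * 4 := fun z hz =>
      (h z).trans (mul_le_mul_of_nonneg_left (by nlinarith [norm_nonneg z]) hC)
    have h1 := hb (x + y) ((norm_add_le _ _).trans (by rw [hx, hy]; norm_num))
    have h2 := hb (x - y) ((norm_sub_le _ _).trans (by rw [hx, hy]; norm_num))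
    have h3 := hb (x + Complex.I • y) ((norm_add_le _ _).trans (by rw [hx, hI]; norm_num))
    have h4 := hb (x - Complex.I • y) ((norm_sub_le _ _).trans (by rw [hx, hI]; norm_num))
    rw [inner_polarization, norm_div, Complex.norm_ofNat, div_le_iff₀ (by norm_num)]
    refine (norm_add_le _ _).trans ?_
    refine (add_le_add_left ((norm_sub_le _ _).trans
      (add_le_add_left (norm_sub_le _ _) _)) _).trans ?_
    simp only [norm_mul, Complex.norm_I, one_mul]
    linarith
  by_cases hx : x = 0
  · simp [hx]
  by_cases hy : y = 0
  · simp [hy]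
  have hx' : (0 : ℝ) < ‖x‖ := norm_pos_iff.2 hx
  have hy' : (0 : ℝ) < ‖y‖ := norm_pos_iff.2 hy
  have := key (((‖x‖⁻¹ : ℝ) : ℂ) • x) (((‖y‖⁻¹ : ℝ) : ℂ) • y)
    (by rw [norm_smul, Complex.norm_real]; simp [hx'.ne'])
    (by rw [norm_smul, Complex.norm_real]; simp [hy'.ne'])
  rw [map_smul, inner_smul_left, inner_smul_right, norm_mul, norm_mul, Complex.conj_ofReal,
    Complex.norm_real, Complex.norm_real, norm_inv, norm_inv, norm_norm, norm_norm] at this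
  calc ‖⟪x, T y⟫_ℂ‖ = (‖x‖⁻¹ * (‖y‖⁻¹ * ‖⟪x, T y⟫_ℂ‖)) * (‖x‖ * ‖y‖) := by field_simp
    _ ≤ 4 * C * (‖x‖ * ‖y‖) := mul_le_mul_of_nonneg_right this (by positivity)
    _ = _ := by ring

variable [CompleteSpace H]

/-- A pointwise limit of uniformly bounded quadratic forms of operators is the quadratic form of
an operator. -/
theorem exists_clm_of_tendsto_inner_self {T : ℕ → H →L[ℂ] H} {q : H → ℂ} {C : ℝ} (hC : 0 ≤ C)
    (hT : ∀ n x, ‖⟪x, T n x⟫_ℂ‖ ≤ C * ‖x‖ ^ 2)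
    (h : ∀ x, Tendsto (fun n => ⟪x, T n x⟫_ℂ) atTop (𝓝 (q x))) :
    ∃ S : H →L[ℂ] H, ∀ x, ⟪x, S x⟫_ℂ = q x := by
  choose b hb using fun x y => (⟨_, tendsto_inner_of_tendsto_inner_self h x y⟩ :
    ∃ c, Tendsto (fun n => ⟪x, T n y⟫_ℂ) atTop (𝓝 c))
  let B₀ : H →ₗ⋆[ℂ] H →ₗ[ℂ] ℂ := LinearMap.mk₂'ₛₗ (starRingEnd ℂ) (RingHom.id ℂ) b
    (fun x x' y => tendsto_nhds_unique (hb _ _)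
      (by simpa only [inner_add_left] using (hb x y).add (hb x' y)))
    (fun c x y => tendsto_nhds_unique (hb _ _)
      (by simpa only [inner_smul_left, smul_eq_mul] using (hb x y).const_mul _))
    (fun x y y' => tendsto_nhds_unique (hb _ _)
      (by simpa only [inner_add_right, map_add] using (hb x y).add (hb x y')))
    (fun c x y => tendsto_nhds_unique (hb _ _)
      (by simpa only [inner_smul_right, map_smul, smul_eq_mul, RingHom.id_apply] using
        (hb x y).const_mul c))
  let B : H →L⋆[ℂ] H →L[ℂ] ℂ := LinearMap.mkContinuous₂ B₀ (4 * C) (fun x y =>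
    le_of_tendsto (hb x y).norm
      (Eventually.of_forall fun n => norm_inner_le_of_inner_self_le hC (hT n) x y))
  refine ⟨ContinuousLinearMap.adjoint (InnerProductSpace.continuousLinearMapOfBilin B),
    fun x => ?_⟩
  rw [ContinuousLinearMap.adjoint_inner_right,
    InnerProductSpace.continuousLinearMapOfBilin_apply]
  exact tendsto_nhds_unique (hb x x) (h x)

end

/-! ### Operators represented by a quadratic family of measures -/

section

variable {α : Type*} [MeasurableSpace α] {H : Type*} [NormedAddCommGroup H]
  [InnerProductSpace ℂ H]

/-- The quadratic form of `T` is `x ↦ ∫ f dμ_x`. -/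
def Represents (μ : H → Measure α) (f : α → ℂ) (T : H →L[ℂ] H) : Prop :=
  ∀ x, ⟪x, T x⟫_ℂ = ∫ a, f a ∂(μ x)

variable {μ : H → Measure α} {f g : α → ℂ} {S T : H →L[ℂ] H}

theorem Represents.unique (hS : Represents μ f S) (hT : Represents μ f T) : S = T :=
  ext_of_inner_self fun x => (hS x).trans (hT x).symm

theorem Represents.smul (hS : Represents μ f S) (c : ℂ) : Represents μ (c • f) (c • S) :=
  fun x => by
    rw [_root_.smul_apply, inner_smul_right, hS x, ← integral_const_mul]
    rfl

theorem Represents.star [CompleteSpace H] (hS : Represents μ f S) :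
    Represents μ (star f) (star S) := fun x => by
  rw [ContinuousLinearMap.star_eq_adjoint, ContinuousLinearMap.adjoint_inner_right,
    ← inner_conj_symm, hS x, ← integral_conj]
  rfl

/-- The total mass of `μ_x` is at most `‖x‖²`. -/
def IsQuadraticallyBounded (μ : H → Measure α) : Prop :=
  ∀ x, μ x Set.univ ≤ ENNReal.ofReal (‖x‖ ^ 2)

omit [InnerProductSpace ℂ H] in
theorem IsQuadraticallyBounded.isFiniteMeasure (hμ : IsQuadraticallyBounded μ) (x : H) :
    IsFiniteMeasure (μ x) :=
  ⟨(hμ x).trans_lt ENNReal.ofReal_lt_top⟩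

theorem Represents.add (hμ : IsQuadraticallyBounded μ) (hf : IsBddMeas f) (hg : IsBddMeas g)
    (hS : Represents μ f S) (hT : Represents μ g T) : Represents μ (f + g) (S + T) := fun x => by
  have := hμ.isFiniteMeasure x
  rw [_root_.add_apply, inner_add_right, hS x, hT x,
    ← integral_add (hf.integrable _) (hg.integrable _)]
  rfl

omit [InnerProductSpace ℂ H] in
theorem IsQuadraticallyBounded.norm_integral_le (hμ : IsQuadraticallyBounded μ) {c : ℝ}
    (hc0 : 0 ≤ c) (hc : ∀ a, ‖f a‖ ≤ c) (x : H) : ‖∫ a, f a ∂(μ x)‖ ≤ c * ‖x‖ ^ 2 := by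
  have := hμ.isFiniteMeasure x
  refine (norm_integral_le_of_norm_le_const (Eventually.of_forall hc)).trans ?_
  refine mul_le_mul_of_nonneg_left ?_ hc0
  exact ENNReal.toReal_le_of_le_ofReal (by positivity) (hμ x)

omit [InnerProductSpace ℂ H] in
theorem IsQuadraticallyBounded.tendsto_integral (hμ : IsQuadraticallyBounded μ)
    {F : ℕ → α → ℂ} {c : ℝ} (hF : ∀ n, Measurable (F n)) (hc : ∀ n a, ‖F n a‖ ≤ c)
    (h : ∀ a, Tendsto (fun n => F n a) atTop (𝓝 (f a))) (x : H) :
    Tendsto (fun n => ∫ a, F n a ∂(μ x)) atTop (𝓝 (∫ a, f a ∂(μ x))) := by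
  have := hμ.isFiniteMeasure x
  exact tendsto_integral_of_dominated_convergence (fun _ => c)
    (fun n => (hF n).aestronglyMeasurable) (integrable_const c)
    (fun n => Eventually.of_forall (hc n)) (Eventually.of_forall h)

/-- Bounded pointwise convergence of functions gives weak convergence of operators. -/
theorem Represents.tendsto_inner (hμ : IsQuadraticallyBounded μ)
    {F : ℕ → α → ℂ} {c : ℝ} (hF : ∀ n, Measurable (F n)) (hc : ∀ n a, ‖F n a‖ ≤ c)
    (h : ∀ a, Tendsto (fun n => F n a) atTop (𝓝 (f a))) {T' : ℕ → H →L[ℂ] H}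
    (hT' : ∀ n, Represents μ (F n) (T' n)) (hT : Represents μ f T) (x y : H) :
    Tendsto (fun n => ⟪x, T' n y⟫_ℂ) atTop (𝓝 ⟪x, T y⟫_ℂ) := by
  rw [inner_polarization]
  refine tendsto_inner_of_tendsto_inner_self (q := fun x => ⟪x, T x⟫_ℂ) (fun x => ?_) x y
  simp_rw [hT x, fun n => hT' n x]
  exact hμ.tendsto_integral hF hc h x

/-- Being represented by an operator passes to bounded pointwise limits, because quadratic forms of
operators pass to the limit. -/
theorem isBoundedClass_represented [CompleteSpace H] (hμ : IsQuadraticallyBounded μ) :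
    IsBoundedClass fun f => ∃ T, Represents μ f T where
  add f g hf hg := fun ⟨S, hS⟩ ⟨T, hT⟩ => ⟨S + T, hS.add hμ hf hg hT⟩
  smul a f _ := fun ⟨S, hS⟩ => ⟨a • S, hS.smul a⟩
  lim F f c hF hc h hr := by
    choose T hT using hr
    have hc' : ∀ n a, ‖F n a‖ ≤ |c| := fun n a => (hc n a).trans (le_abs_self c)
    refine exists_clm_of_tendsto_inner_self (T := T) (abs_nonneg c) (fun n x => ?_)
      (fun x => ?_)
    · rw [hT n x]
      exact hμ.norm_integral_le (abs_nonneg c) (hc' n) x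
    · simp_rw [fun n => hT n x]
      exact hμ.tendsto_integral hF hc h x

open Classical in
/-- The operator with quadratic form `x ↦ ∫ f dμ_x`, when there is one, and `0` otherwise. -/
def boundedCalc (μ : H → Measure α) (f : α → ℂ) : H →L[ℂ] H :=
  if h : ∃ T, Represents μ f T then h.choose else 0

theorem Represents.boundedCalc_eq (h : Represents μ f T) : boundedCalc μ f = T := by
  have hex : ∃ T, Represents μ f T := ⟨T, h⟩
  rw [boundedCalc, dif_pos hex]
  exact hex.choose_spec.unique h

/-- Quadratically bounded families of measures that represent every bounded measurable function
by an operator. -/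
structure HasBoundedCalc (μ : H → Measure α) : Prop where
  bdd : IsQuadraticallyBounded μ
  exists_represents : ∀ f, IsBddMeas f → ∃ T, Represents μ f T

namespace HasBoundedCalc

variable (hμ : HasBoundedCalc μ)
include hμ

theorem represents (hf : IsBddMeas f) : Represents μ f (boundedCalc μ f) := by
  obtain ⟨T, hT⟩ := hμ.exists_represents f hf
  rwa [hT.boundedCalc_eq]

theorem calc_add (hf : IsBddMeas f) (hg : IsBddMeas g) :
    boundedCalc μ (f + g) = boundedCalc μ f + boundedCalc μ g :=
  ((hμ.represents hf).add hμ.bdd hf hg (hμ.represents hg)).boundedCalc_eq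

theorem calc_smul (c : ℂ) (hf : IsBddMeas f) :
    boundedCalc μ (c • f) = c • boundedCalc μ f :=
  ((hμ.represents hf).smul c).boundedCalc_eq

theorem calc_sub (hf : IsBddMeas f) (hg : IsBddMeas g) :
    boundedCalc μ (f - g) = boundedCalc μ f - boundedCalc μ g := by
  have := hμ.calc_add hf (hg.smul (-1))
  rw [hμ.calc_smul _ hg] at this
  simpa [sub_eq_add_neg] using this

theorem calc_star [CompleteSpace H] (hf : IsBddMeas f) :
    boundedCalc μ (star f) = star (boundedCalc μ f) :=
  (hμ.represents hf).star.boundedCalc_eq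

theorem tendsto_inner_calc {F : ℕ → α → ℂ} {c : ℝ} (hF : ∀ n, Measurable (F n))
    (hc : ∀ n a, ‖F n a‖ ≤ c) (h : ∀ a, Tendsto (fun n => F n a) atTop (𝓝 (f a))) (x y : H) :
    Tendsto (fun n => ⟪x, boundedCalc μ (F n) y⟫_ℂ) atTop (𝓝 ⟪x, boundedCalc μ f y⟫_ℂ) :=
  Represents.tendsto_inner hμ.bdd hF hc h (fun n => hμ.represents ⟨hF n, c, hc n⟩)
    (hμ.represents (IsBddMeas.of_tendsto hF hc h)) x y

theorem isBoundedClass_mul_right (hg : IsBddMeas g) :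
    IsBoundedClass fun f => boundedCalc μ (f * g) = boundedCalc μ f * boundedCalc μ g where
  add f f' hf hf' h h' := by
    rw [add_mul, hμ.calc_add (hf.mul hg) (hf'.mul hg), h, h', hμ.calc_add hf hf', add_mul]
  smul c f hf h := by
    rw [smul_mul_assoc, hμ.calc_smul c (hf.mul hg), h, hμ.calc_smul c hf, smul_mul_assoc]
  lim F f c hF hc h hr := by
    obtain ⟨d, hd⟩ := hg.bdd
    ext y
    refine ext_inner_left ℂ fun x => ?_
    refine tendsto_nhds_unique (hμ.tendsto_inner_calc (F := fun n => F n * g) (c := c * d)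
      (fun n => (hF n).mul hg.measurable) (fun n a => ?_) (fun a => (h a).mul_const _) x y) ?_
    · rw [Pi.mul_apply, norm_mul]
      exact mul_le_mul (hc n a) (hd a) (norm_nonneg _) ((norm_nonneg _).trans (hc n a))
    · simp_rw [hr]
      exact hμ.tendsto_inner_calc hF hc h x _

theorem isBoundedClass_mul_left [CompleteSpace H] (hf : IsBddMeas f) :
    IsBoundedClass fun g => boundedCalc μ (f * g) = boundedCalc μ f * boundedCalc μ g where
  add g g' hg hg' h h' := by
    rw [mul_add, hμ.calc_add (hf.mul hg) (hf.mul hg'), h, h', hμ.calc_add hg hg', mul_add]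
  smul c g hg h := by
    rw [mul_smul_comm, hμ.calc_smul c (hf.mul hg), h, hμ.calc_smul c hg, mul_smul_comm]
  lim G g c hG hc h hr := by
    obtain ⟨d, hd⟩ := hf.bdd
    ext y
    refine ext_inner_left ℂ fun x => ?_
    refine tendsto_nhds_unique (hμ.tendsto_inner_calc (F := fun n => f * G n) (c := d * c)
      (fun n => hf.measurable.mul (hG n)) (fun n a => ?_) (fun a => (h a).const_mul _) x y) ?_
    · rw [Pi.mul_apply, norm_mul]
      exact mul_le_mul (hd a) (hc n a) (norm_nonneg _) ((norm_nonneg _).trans (hd a))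
    · simp_rw [hr, mul_apply_eq_comp,
        ← ContinuousLinearMap.adjoint_inner_left (boundedCalc μ f)]
      exact hμ.tendsto_inner_calc hG hc h _ y

end HasBoundedCalc

end

/-! ### Bounded functional calculus of a projection-valued measure -/

namespace ProjectionValuedMeasure

variable {α : Type*} [MeasurableSpace α] {H : Type*}
  [NormedAddCommGroup H] [InnerProductSpace ℂ H] [CompleteSpace H]
  (E : ProjectionValuedMeasure α H) {f g : α → ℂ}

theorem scalarMeasure_apply (x : H) {s : Set α} (hs : MeasurableSet s) :
    E.scalarMeasure x s = ENNReal.ofReal (⟪x, E.proj s x⟫_ℂ).re :=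
  Measure.ofMeasurable_apply s hs

theorem inner_proj_eq (x : H) {s : Set α} (hs : MeasurableSet s) :
    ⟪x, E.proj s x⟫_ℂ = (‖E.proj s x‖ ^ 2 : ℝ) := by
  have h := E.isStarProjection_proj s hs
  have h1 : E.proj s x = E.proj s (E.proj s x) := by
    rw [← mul_apply_eq_comp, h.isIdempotentElem.eq]
  have h2 : ContinuousLinearMap.adjoint (E.proj s) = E.proj s := by
    rw [← ContinuousLinearMap.star_eq_adjoint, h.isSelfAdjoint.star_eq]
  conv_lhs => rw [h1]
  rw [← ContinuousLinearMap.adjoint_inner_left, h2, inner_self_eq_norm_sq_to_K]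
  simp

theorem scalarMeasure_apply' (x : H) {s : Set α} (hs : MeasurableSet s) :
    E.scalarMeasure x s = ENNReal.ofReal (‖E.proj s x‖ ^ 2) := by
  rw [E.scalarMeasure_apply x hs, E.inner_proj_eq x hs, Complex.ofReal_re]

theorem isQuadraticallyBounded : IsQuadraticallyBounded E.scalarMeasure := fun x => by
  rw [E.scalarMeasure_apply' x MeasurableSet.univ, E.proj_univ]
  rfl

instance (x : H) : IsFiniteMeasure (E.scalarMeasure x) :=
  E.isQuadraticallyBounded.isFiniteMeasure x

theorem represents_indicator {s : Set α} (hs : MeasurableSet s) :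
    Represents E.scalarMeasure (s.indicator 1) (E.proj s) := fun x => by
  have h1 : ∫ a, s.indicator (1 : α → ℂ) a ∂(E.scalarMeasure x) =
      ((E.scalarMeasure x).real s : ℂ) := by
    rw [integral_indicator hs]
    simp
  rw [h1, E.inner_proj_eq x hs, measureReal_def,
    E.scalarMeasure_apply' x hs, ENNReal.toReal_ofReal (by positivity)]

theorem hasBoundedCalc : HasBoundedCalc E.scalarMeasure where
  bdd := E.isQuadraticallyBounded
  exists_represents _ hf := (isBoundedClass_represented E.isQuadraticallyBounded).of_indicator
    (fun _ hs => ⟨_, E.represents_indicator hs⟩) hf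

/-- The bounded operator `∫ f dE` for bounded measurable `f`. For other `f` it is `0`, unless some
bounded operator has the quadratic form `x ↦ ∫ f dE_x`. -/
def bcalc (f : α → ℂ) : H →L[ℂ] H := boundedCalc E.scalarMeasure f

theorem inner_bcalc_self (hf : IsBddMeas f) (x : H) :
    ⟪x, E.bcalc f x⟫_ℂ = ∫ a, f a ∂(E.scalarMeasure x) :=
  E.hasBoundedCalc.represents hf x

theorem bcalc_indicator {s : Set α} (hs : MeasurableSet s) :
    E.bcalc (s.indicator 1) = E.proj s :=
  (E.represents_indicator hs).boundedCalc_eq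

theorem bcalc_one : E.bcalc 1 = 1 := by
  rw [← Set.indicator_univ (1 : α → ℂ), E.bcalc_indicator MeasurableSet.univ, E.proj_univ]

theorem bcalc_add (hf : IsBddMeas f) (hg : IsBddMeas g) :
    E.bcalc (f + g) = E.bcalc f + E.bcalc g := E.hasBoundedCalc.calc_add hf hg

theorem bcalc_sub (hf : IsBddMeas f) (hg : IsBddMeas g) :
    E.bcalc (f - g) = E.bcalc f - E.bcalc g := E.hasBoundedCalc.calc_sub hf hg

theorem bcalc_smul (c : ℂ) (hf : IsBddMeas f) : E.bcalc (c • f) = c • E.bcalc f :=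
  E.hasBoundedCalc.calc_smul c hf

theorem bcalc_star (hf : IsBddMeas f) : E.bcalc (star f) = star (E.bcalc f) :=
  E.hasBoundedCalc.calc_star hf

theorem proj_union {s t : Set α} (hs : MeasurableSet s) (ht : MeasurableSet t)
    (hd : Disjoint s t) : E.proj (s ∪ t) = E.proj s + E.proj t := by
  rw [← E.bcalc_indicator (hs.union ht), ← E.bcalc_indicator hs, ← E.bcalc_indicator ht,
    ← E.bcalc_add (.indicator_one hs) (.indicator_one ht)]
  congr 1
  exact Set.indicator_union_of_disjoint hd _

/-- The projections of disjoint sets are orthogonal, because their sum is a projection: then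
`P Q + Q P = 0`, which forces `P Q = -P Q P = Q P`. -/
theorem proj_mul_of_disjoint {s t : Set α} (hs : MeasurableSet s) (ht : MeasurableSet t)
    (hd : Disjoint s t) : E.proj s * E.proj t = 0 := by
  have hP := (E.isStarProjection_proj s hs).isIdempotentElem.eq
  have hQ := (E.isStarProjection_proj t ht).isIdempotentElem.eq
  have hPQ := (E.isStarProjection_proj _ (hs.union ht)).isIdempotentElem.eq
  rw [E.proj_union hs ht hd] at hPQ
  set P := E.proj s
  set Q := E.proj t
  have h1 : P * Q + Q * P = 0 := by
    have : P * P + P * Q + (Q * P + Q * Q) = P + Q := by rw [← hPQ]; noncomm_ring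
    rw [hP, hQ] at this
    have h2 : P * Q + Q * P = (P + P * Q + (Q * P + Q)) - (P + Q) := by abel
    rw [h2, this, sub_self]
  have h2 : P * Q + P * Q * P = 0 := by
    have := congrArg (P * ·) h1
    simp only [mul_add, mul_zero, ← mul_assoc, hP] at this
    exact this
  have h3 : P * Q * P + Q * P = 0 := by
    have := congrArg (· * P) h1
    simp only [add_mul, zero_mul, mul_assoc, hP] at this
    rw [mul_assoc]
    exact this
  have h4 : P * Q = Q * P := by
    rw [eq_neg_of_add_eq_zero_left h2, eq_neg_of_add_eq_zero_right h3]
  rw [← h4, ← two_smul ℂ] at h1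
  exact (smul_eq_zero.1 h1).resolve_left two_ne_zero

theorem proj_inter {s t : Set α} (hs : MeasurableSet s) (ht : MeasurableSet t) :
    E.proj (s ∩ t) = E.proj s * E.proj t := by
  have h1 : E.proj s = E.proj (s \ t) + E.proj (s ∩ t) := by
    rw [← E.proj_union (hs.diff ht) (hs.inter ht)
      (Set.disjoint_sdiff_left.mono_right Set.inter_subset_right), Set.sdiff_union_inter]
  have h2 : E.proj t = E.proj (t \ s) + E.proj (s ∩ t) := by
    rw [Set.inter_comm, ← E.proj_union (ht.diff hs) (ht.inter hs)
      (Set.disjoint_sdiff_left.mono_right Set.inter_subset_right), Set.sdiff_union_inter]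
  rw [h1, h2, add_mul, mul_add, mul_add,
    E.proj_mul_of_disjoint (hs.diff ht) (ht.diff hs)
      (Set.disjoint_sdiff_left.mono_right Set.sdiff_subset),
    E.proj_mul_of_disjoint (hs.diff ht) (hs.inter ht)
      (Set.disjoint_sdiff_left.mono_right Set.inter_subset_right),
    E.proj_mul_of_disjoint (hs.inter ht) (ht.diff hs)
      (Set.disjoint_sdiff_right.mono_left Set.inter_subset_left),
    (E.isStarProjection_proj _ (hs.inter ht)).isIdempotentElem.eq]
  simp

theorem bcalc_mul (hf : IsBddMeas f) (hg : IsBddMeas g) :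
    E.bcalc (f * g) = E.bcalc f * E.bcalc g := by
  refine (E.hasBoundedCalc.isBoundedClass_mul_left hf).of_indicator (fun t ht => ?_) hg
  refine (E.hasBoundedCalc.isBoundedClass_mul_right (.indicator_one ht)).of_indicator
    (fun s hs => ?_) hf
  have h : s.indicator (1 : α → ℂ) * t.indicator 1 = (s ∩ t).indicator 1 :=
    Set.inter_indicator_one.symm
  rw [h]
  exact ((E.bcalc_indicator (hs.inter ht)).trans (E.proj_inter hs ht)).trans
    (congrArg₂ _ (E.bcalc_indicator hs).symm (E.bcalc_indicator ht).symm)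

theorem inner_bcalc_bcalc (hf : IsBddMeas f) (hg : IsBddMeas g) (x : H) :
    ⟪E.bcalc f x, E.bcalc g x⟫_ℂ = ∫ a, star (f a) * g a ∂(E.scalarMeasure x) := by
  rw [← ContinuousLinearMap.adjoint_inner_right, ← ContinuousLinearMap.star_eq_adjoint,
    ← E.bcalc_star hf, ← mul_apply_eq_comp, ← E.bcalc_mul hf.star hg,
    E.inner_bcalc_self (hf.star.mul hg)]
  rfl

theorem norm_bcalc_sq (hf : IsBddMeas f) (x : H) :
    ‖E.bcalc f x‖ ^ 2 = ∫ a, ‖f a‖ ^ 2 ∂(E.scalarMeasure x) := by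
  have h := E.inner_bcalc_bcalc hf hf x
  rw [inner_self_eq_norm_sq_to_K] at h
  have h2 : ∀ a, star (f a) * f a = ((‖f a‖ ^ 2 : ℝ) : ℂ) := fun a => by
    rw [Complex.star_def, ← Complex.normSq_eq_conj_mul_self, Complex.normSq_eq_norm_sq]
  simp_rw [h2] at h
  rw [integral_complex_ofReal] at h
  refine Complex.ofReal_injective (Eq.trans ?_ h)
  simp

/-- The vector `f(E) x` has scalar measure `‖f‖² E_x`. -/
theorem scalarMeasure_bcalc (hf : IsBddMeas f) (x : H) :
    E.scalarMeasure (E.bcalc f x) = (E.scalarMeasure x).withDensity (fun a => ‖f a‖ₑ ^ 2) := by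
  ext s hs
  have hi := IsBddMeas.indicator_one (α := α) hs
  rw [withDensity_apply _ hs, E.scalarMeasure_apply' _ hs, ← E.bcalc_indicator hs,
    ← mul_apply_eq_comp, ← E.bcalc_mul hi hf, E.norm_bcalc_sq (hi.mul hf),
    ofReal_integral_eq_lintegral_ofReal]
  · rw [← lintegral_indicator hs]
    refine lintegral_congr fun a => ?_
    by_cases ha : a ∈ s
    · simp [ha, ENNReal.ofReal_pow]
    · simp [ha]
  · have := ((hi.mul hf).mul (hi.mul hf).star).integrable (E.scalarMeasure x)
    convert this.norm using 2 with a
    simp [sq]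
  · exact Eventually.of_forall fun a => by positivity

theorem isBoundedClass_intertwine (E F : ProjectionValuedMeasure α H) (V : H →L[ℂ] H) :
    IsBoundedClass fun f => V * E.bcalc f = F.bcalc f * V where
  add f g hf hg h h' := by
    rw [E.bcalc_add hf hg, F.bcalc_add hf hg, mul_add, add_mul, h, h']
  smul c f hf h := by
    rw [E.bcalc_smul c hf, F.bcalc_smul c hf, mul_smul_comm, smul_mul_assoc, h]
  lim G f c hG hc h hr := by
    ext y
    refine ext_inner_left ℂ fun x => ?_
    have h1 := E.hasBoundedCalc.tendsto_inner_calc hG hc h (ContinuousLinearMap.adjoint V x) y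
    have h2 := F.hasBoundedCalc.tendsto_inner_calc hG hc h x (V y)
    simp_rw [ContinuousLinearMap.adjoint_inner_left] at h1
    refine tendsto_nhds_unique h1 (h2.congr fun n => ?_)
    exact congrArg (fun T : H →L[ℂ] H => ⟪x, T y⟫_ℂ) (hr n).symm

/-- Intertwining the spectral projections of two projection-valued measures intertwines their
bounded functional calculi. -/
theorem bcalc_intertwine {F : ProjectionValuedMeasure α H} {V : H →L[ℂ] H}
    (h : ∀ s, MeasurableSet s → V * E.proj s = F.proj s * V) (hf : IsBddMeas f) :
    V * E.bcalc f = F.bcalc f * V := by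
  exact (isBoundedClass_intertwine E F V).of_indicator (fun s hs => by
    rw [E.bcalc_indicator hs, F.bcalc_indicator hs, h s hs]) hf

end ProjectionValuedMeasure

/-! ### Unbounded integrals against a projection-valued measure -/

section Trunc

variable {α : Type*} [MeasurableSpace α]

/-- The truncation of `f` to the set where `‖f‖ ≤ n`. -/
def trunc (f : α → ℂ) (n : ℕ) : α → ℂ := {a | ‖f a‖ ≤ n}.indicator f

variable {f : α → ℂ}

theorem measurableSet_norm_le (hf : Measurable f) (n : ℕ) : MeasurableSet {a | ‖f a‖ ≤ n} :=
  measurableSet_le hf.norm measurable_const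

omit [MeasurableSpace α] in
theorem norm_trunc_le (f : α → ℂ) (n : ℕ) (a : α) : ‖trunc f n a‖ ≤ ‖f a‖ :=
  norm_indicator_le_norm_self _ _

omit [MeasurableSpace α] in
theorem trunc_eq {n : ℕ} {a : α} (h : ‖f a‖ ≤ n) : trunc f n a = f a :=
  Set.indicator_of_mem (s := {a | ‖f a‖ ≤ n}) h f

omit [MeasurableSpace α] in
theorem trunc_eq_zero {n : ℕ} {a : α} (h : ¬‖f a‖ ≤ n) : trunc f n a = 0 :=
  Set.indicator_of_notMem (s := {a | ‖f a‖ ≤ n}) h f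

theorem isBddMeas_trunc (hf : Measurable f) (n : ℕ) : IsBddMeas (trunc f n) :=
  ⟨hf.indicator (measurableSet_norm_le hf n), n, fun a => by
    by_cases h : ‖f a‖ ≤ n
    · rwa [trunc_eq h]
    · rw [trunc_eq_zero h]; simp⟩

omit [MeasurableSpace α] in
theorem tendsto_trunc (f : α → ℂ) (a : α) :
    Tendsto (fun n => trunc f n a) atTop (𝓝 (f a)) := by
  refine tendsto_const_nhds.congr' ?_
  filter_upwards [eventually_ge_atTop ⌈‖f a‖⌉₊] with n hn
  exact (trunc_eq ((Nat.le_ceil _).trans (by exact_mod_cast hn))).symm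

end Trunc

namespace ProjectionValuedMeasure

variable {α : Type*} [MeasurableSpace α] {H : Type*}
  [NormedAddCommGroup H] [InnerProductSpace ℂ H] [CompleteSpace H]
  (E : ProjectionValuedMeasure α H) {f g : α → ℂ}

theorem scalarMeasure_zero : E.scalarMeasure 0 = 0 := by
  ext s hs
  simp [E.scalarMeasure_apply' _ hs]

theorem scalarMeasure_smul (c : ℂ) (x : H) :
    E.scalarMeasure (c • x) = ENNReal.ofReal (‖c‖ ^ 2) • E.scalarMeasure x := by
  ext s hs
  rw [Measure.smul_apply, E.scalarMeasure_apply' _ hs, E.scalarMeasure_apply' _ hs, map_smul,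
    norm_smul, mul_pow, ENNReal.ofReal_mul (by positivity), smul_eq_mul]

theorem scalarMeasure_add_le (x y : H) :
    E.scalarMeasure (x + y) ≤ (2 : ℝ≥0∞) • (E.scalarMeasure x + E.scalarMeasure y) := by
  refine Measure.le_iff.2 fun s hs => ?_
  rw [Measure.smul_apply, Measure.add_apply, E.scalarMeasure_apply' _ hs,
    E.scalarMeasure_apply' _ hs, E.scalarMeasure_apply' _ hs, map_add,
    ← ENNReal.ofReal_add (by positivity) (by positivity), smul_eq_mul,
    ← ENNReal.ofReal_ofNat, ← ENNReal.ofReal_mul (by norm_num)]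
  refine ENNReal.ofReal_le_ofReal ?_
  have h := norm_add_le (E.proj s x) (E.proj s y)
  nlinarith [norm_nonneg (E.proj s x + E.proj s y), sq_nonneg (‖E.proj s x‖ - ‖E.proj s y‖)]

/-- The vectors `x` with `∫ ‖f‖² dE_x < ∞`. -/
def intDomain (f : α → ℂ) : Submodule ℂ H where
  carrier := {x | MemLp f 2 (E.scalarMeasure x)}
  zero_mem' := by simp [E.scalarMeasure_zero]
  add_mem' {x y} hx hy := by
    refine MemLp.of_measure_le_smul (c := 2) (by norm_num) (E.scalarMeasure_add_le x y) ?_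
    have hm := hx.1.add_measure hy.1
    refine (memLp_two_iff_integrable_sq_norm hm).2 (Integrable.add_measure ?_ ?_)
    · exact (memLp_two_iff_integrable_sq_norm hx.1).1 hx
    · exact (memLp_two_iff_integrable_sq_norm hy.1).1 hy
  smul_mem' c x hx := by
    change MemLp f 2 (E.scalarMeasure (c • x))
    rw [E.scalarMeasure_smul]
    exact hx.smul_measure ENNReal.ofReal_ne_top

theorem mem_intDomain {x : H} : x ∈ E.intDomain f ↔ MemLp f 2 (E.scalarMeasure x) := Iff.rfl

theorem integrable_norm_sq {x : H} (hx : x ∈ E.intDomain f) :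
    Integrable (fun a => ‖f a‖ ^ 2) (E.scalarMeasure x) :=
  hx.integrable_norm_pow (by norm_num)

theorem cauchySeq_bcalc_trunc (hf : Measurable f) {x : H} (hx : x ∈ E.intDomain f) :
    CauchySeq fun n => E.bcalc (trunc f n) x := by
  have hint := E.integrable_norm_sq hx
  set b : ℕ → ℝ := fun N => ∫ a, {a | ‖f a‖ ≤ N}ᶜ.indicator (fun a => ‖f a‖ ^ 2) a
    ∂(E.scalarMeasure x) with hb
  have hbi : ∀ N : ℕ, Integrable ({a | ‖f a‖ ≤ N}ᶜ.indicator (fun a => ‖f a‖ ^ 2))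
    (E.scalarMeasure x) := fun N => hint.indicator (measurableSet_norm_le hf N).compl
  have hlim : Tendsto b atTop (𝓝 0) := by
    have : Tendsto b atTop (𝓝 (∫ a, (0 : ℝ) ∂(E.scalarMeasure x))) := by
      refine tendsto_integral_of_dominated_convergence (fun a => ‖f a‖ ^ 2)
        (fun N => (hbi N).aestronglyMeasurable) hint
        (fun N => Eventually.of_forall fun a => ?_) (Eventually.of_forall fun a => ?_)
      · refine (norm_indicator_le_norm_self _ _).trans ?_
        simp
      · refine tendsto_const_nhds.congr' ?_
        filter_upwards [eventually_ge_atTop ⌈‖f a‖⌉₊] with n hn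
        have : ‖f a‖ ≤ n := (Nat.le_ceil _).trans (by exact_mod_cast hn)
        simp [this]
    simpa using this
  -- for `n, m ≥ N` the truncations agree where `‖f‖ ≤ N`, and differ by at most `‖f‖` elsewhere
  refine cauchySeq_of_le_tendsto_0 (fun N => √(b N)) (fun n m N hn hm => ?_) ?_
  · rw [dist_eq_norm, ← _root_.sub_apply,
      ← E.bcalc_sub (isBddMeas_trunc hf n) (isBddMeas_trunc hf m)]
    refine Real.le_sqrt_of_sq_le ?_
    rw [E.norm_bcalc_sq ((isBddMeas_trunc hf n).sub (isBddMeas_trunc hf m))]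
    refine integral_mono_of_nonneg (Eventually.of_forall fun a => by positivity) (hbi N)
      (Eventually.of_forall fun a => ?_)
    have hn' : (N : ℝ) ≤ n := by exact_mod_cast hn
    have hm' : (N : ℝ) ≤ m := by exact_mod_cast hm
    simp only [Pi.sub_apply]
    by_cases h : ‖f a‖ ≤ N
    · rw [trunc_eq (h.trans hn'), trunc_eq (h.trans hm')]
      simp [h]
    · rw [Set.indicator_of_mem (by exact h)]
      have : ‖trunc f n a - trunc f m a‖ ≤ ‖f a‖ := by
        by_cases h1 : ‖f a‖ ≤ n <;> by_cases h2 : ‖f a‖ ≤ m <;>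
          simp [trunc_eq, trunc_eq_zero, h1, h2]
      gcongr
  · simpa using hlim.sqrt

/-- Existence of `∫ f dE`, together with its description as a strong limit. -/
theorem exists_isIntegral_tendsto (hf : Measurable f) : ∃ T : H →ₗ.[ℂ] H, E.IsIntegral f T ∧
    ∀ x : T.domain, Tendsto (fun n => E.bcalc (trunc f n) x) atTop (𝓝 (T x)) := by
  choose T hT using fun x : E.intDomain f =>
    cauchySeq_tendsto_of_complete (E.cauchySeq_bcalc_trunc hf x.2)
  let T' : H →ₗ.[ℂ] H := ⟨E.intDomain f,
    { toFun := T
      map_add' := fun x y => tendsto_nhds_unique (hT (x + y))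
        (by simpa only [Submodule.coe_add, map_add] using (hT x).add (hT y))
      map_smul' := fun c x => tendsto_nhds_unique (hT (c • x))
        (by simpa only [Submodule.coe_smul, map_smul] using! (hT x).const_smul c) }⟩
  refine ⟨T', ⟨fun x => Iff.rfl, fun x => ?_⟩, hT⟩
  have h1 : Tendsto (fun n => ⟪(x : H), E.bcalc (trunc f n) x⟫_ℂ) atTop (𝓝 ⟪(x : H), T' x⟫_ℂ) :=
    tendsto_const_nhds.inner (hT x)
  refine tendsto_nhds_unique h1 ?_
  simp_rw [fun n => E.inner_bcalc_self (isBddMeas_trunc hf n) (x : H)]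
  have hfi : Integrable f (E.scalarMeasure x) := MemLp.integrable (by norm_num) x.2
  exact tendsto_integral_of_dominated_convergence (fun a => ‖f a‖)
    (fun n => (isBddMeas_trunc hf n).measurable.aestronglyMeasurable) hfi.norm
    (fun n => Eventually.of_forall fun a => norm_trunc_le f n a)
    (Eventually.of_forall fun a => tendsto_trunc f a)

/-- If `f g` is bounded, the range of `∫ g dE` lies in the domain of `∫ f dE`, since
`∫ ‖f‖² dE_{g(E) y} = ∫ ‖f g‖² dE_y`. -/
theorem bcalc_mem_intDomain (hg : IsBddMeas g) (hfg : IsBddMeas (f * g))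
    (hf : Measurable f) (y : H) : E.bcalc g y ∈ E.intDomain f := by
  rw [mem_intDomain, memLp_two_iff_integrable_sq_norm hf.aestronglyMeasurable,
    E.scalarMeasure_bcalc hg]
  refine ⟨(hf.norm.pow_const 2).aestronglyMeasurable, ?_⟩
  rw [hasFiniteIntegral_iff_enorm, lintegral_withDensity_eq_lintegral_mul₀
    (hg.measurable.enorm.pow_const 2).aemeasurable (hf.norm.pow_const 2).enorm.aemeasurable]
  have := ((hfg.mul hfg).integrable (E.scalarMeasure y)).2
  rw [hasFiniteIntegral_iff_enorm] at this
  refine lt_of_le_of_lt (le_of_eq (lintegral_congr fun a => ?_)) this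
  simp only [Pi.mul_apply, enorm_mul, enorm_pow, enorm_norm]
  ring

/-- The domain contains the ranges of the projections of `{‖f‖ ≤ n}`, which increase to `1`. -/
theorem dense_intDomain (hf : Measurable f) : Dense (E.intDomain f : Set H) := by
  rw [Submodule.dense_iff_topologicalClosure_eq_top, Submodule.topologicalClosure_eq_top_iff,
    Submodule.eq_bot_iff]
  intro y hy
  have hm := measurableSet_norm_le hf
  have hmem : ∀ n : ℕ, E.bcalc ({a | ‖f a‖ ≤ n}.indicator 1) y ∈ E.intDomain f := fun n =>
    E.bcalc_mem_intDomain (.indicator_one (hm n)) (by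
      have h : f * {a | ‖f a‖ ≤ n}.indicator 1 = trunc f n := by
        ext a
        by_cases h : ‖f a‖ ≤ n <;> simp [trunc, h]
      rw [h]
      exact isBddMeas_trunc hf n) hf y
  have h1 := E.hasBoundedCalc.tendsto_inner_calc (f := 1) (c := 1)
    (F := fun n : ℕ => {a | ‖f a‖ ≤ n}.indicator 1)
    (fun n => (IsBddMeas.indicator_one (hm n)).measurable)
    (fun n a => by by_cases h : ‖f a‖ ≤ n <;> simp [h])
    (fun a => by
      refine tendsto_const_nhds.congr' ?_
      filter_upwards [eventually_ge_atTop ⌈‖f a‖⌉₊] with n hn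
      have : ‖f a‖ ≤ n := (Nat.le_ceil _).trans (by exact_mod_cast hn)
      simp [this]) y y
  have h2 : ∀ n : ℕ, ⟪y, boundedCalc E.scalarMeasure ({a | ‖f a‖ ≤ n}.indicator 1) y⟫_ℂ = 0 :=
    fun n => (Submodule.mem_orthogonal' _ _).1 hy _ (hmem n)
  simp_rw [h2] at h1
  have h3 := tendsto_nhds_unique tendsto_const_nhds h1
  have h4 : boundedCalc E.scalarMeasure 1 = 1 := E.bcalc_one
  rw [h4] at h3
  exact inner_self_eq_zero.1 h3.symm

variable {E}

theorem IsIntegral.domain_eq {T : H →ₗ.[ℂ] H} (hT : E.IsIntegral f T) :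
    T.domain = E.intDomain f :=
  Submodule.ext hT.1

/-- The quadratic form and the domain determine the operator, by polarisation on the domain and
density. -/
theorem IsIntegral.unique (hf : Measurable f) {S T : H →ₗ.[ℂ] H} (hS : E.IsIntegral f S)
    (hT : E.IsIntegral f T) : S = T := by
  obtain ⟨D, S⟩ := S
  obtain ⟨D', T⟩ := T
  obtain rfl : D = D' := hS.domain_eq.trans hT.domain_eq.symm
  have hd : Dense (D : Set H) := by
    have : D = E.intDomain f := hS.domain_eq
    rw [this]
    exact E.dense_intDomain hf
  congr 1
  ext y
  refine hd.eq_of_inner_right ℂ fun x hx => ?_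
  have key : ∀ z : D, ⟪D.subtype z, S z⟫_ℂ = ⟪D.subtype z, T z⟫_ℂ := fun z =>
    (hS.2 z).trans (hT.2 z).symm
  have h1 := inner_polarization_comp D.subtype S ⟨x, hx⟩ y
  rw [key, key, key, key, ← inner_polarization_comp D.subtype T ⟨x, hx⟩ y] at h1
  exact h1

theorem IsIntegral.tendsto (hf : Measurable f) {T : H →ₗ.[ℂ] H} (hT : E.IsIntegral f T)
    (x : T.domain) : Tendsto (fun n => E.bcalc (trunc f n) x) atTop (𝓝 (T x)) := by
  obtain ⟨S, hS, hS'⟩ := E.exists_isIntegral_tendsto hf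
  obtain rfl := hS.unique hf hT
  exact hS' x

theorem IsIntegral.integral_eq (hf : Measurable f) {T : H →ₗ.[ℂ] H} (hT : E.IsIntegral f T) :
    E.integral f = T := by
  have h : ∃ T : H →ₗ.[ℂ] H, E.IsIntegral f T := ⟨T, hT⟩
  rw [integral, dif_pos h]
  exact h.choose_spec.unique hf hT

variable (E) in
theorem isIntegral_integral (hf : Measurable f) : E.IsIntegral f (E.integral f) := by
  obtain ⟨T, hT, -⟩ := E.exists_isIntegral_tendsto hf
  rwa [hT.integral_eq hf]

/-- `(∫ g dE)(∫ f dE) ⊆ ∫ g f dE` when `g` and `g f` are bounded. -/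
theorem IsIntegral.bcalc_apply (hf : Measurable f) {T : H →ₗ.[ℂ] H} (hT : E.IsIntegral f T)
    (hg : IsBddMeas g) (hgf : IsBddMeas (g * f)) (x : T.domain) :
    E.bcalc g (T x) = E.bcalc (g * f) x := by
  refine ext_inner_left ℂ fun y => ?_
  have h1 : Tendsto (fun n => ⟪y, E.bcalc g (E.bcalc (trunc f n) x)⟫_ℂ) atTop
      (𝓝 ⟪y, E.bcalc g (T x)⟫_ℂ) :=
    tendsto_const_nhds.inner ((E.bcalc g).continuous.tendsto _ |>.comp (hT.tendsto hf x))
  refine tendsto_nhds_unique h1 ?_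
  simp_rw [← mul_apply_eq_comp, fun n => (E.bcalc_mul hg (isBddMeas_trunc hf n)).symm]
  obtain ⟨c, hc⟩ := hgf.bdd
  refine E.hasBoundedCalc.tendsto_inner_calc (c := c)
    (fun n => (hg.mul (isBddMeas_trunc hf n)).measurable) (fun n a => ?_)
    (fun a => (tendsto_trunc f a).const_mul _) y x
  refine le_trans ?_ (hc a)
  rw [Pi.mul_apply, Pi.mul_apply, norm_mul, norm_mul]
  exact mul_le_mul_of_nonneg_left (norm_trunc_le f n a) (norm_nonneg _)

/-- `(∫ f dE)(∫ g dE) = ∫ f g dE` when `g` and `f g` are bounded. -/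
theorem IsIntegral.apply_bcalc (hf : Measurable f) {T : H →ₗ.[ℂ] H} (hT : E.IsIntegral f T)
    (hg : IsBddMeas g) (hfg : IsBddMeas (f * g)) (y : H) :
    ∃ h : E.bcalc g y ∈ T.domain, T ⟨E.bcalc g y, h⟩ = E.bcalc (f * g) y := by
  have h := E.bcalc_mem_intDomain hg hfg hf y
  rw [← hT.domain_eq] at h
  refine ⟨h, ext_inner_left ℂ fun z => ?_⟩
  refine tendsto_nhds_unique (tendsto_const_nhds.inner (hT.tendsto hf ⟨_, h⟩)) ?_
  simp_rw [← mul_apply_eq_comp, fun n => (E.bcalc_mul (isBddMeas_trunc hf n) hg).symm]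
  obtain ⟨c, hc⟩ := hfg.bdd
  refine E.hasBoundedCalc.tendsto_inner_calc (c := c)
    (fun n => ((isBddMeas_trunc hf n).mul hg).measurable) (fun n a => ?_)
    (fun a => (tendsto_trunc f a).mul_const _) z y
  refine le_trans ?_ (hc a)
  rw [Pi.mul_apply, Pi.mul_apply, norm_mul, norm_mul]
  exact mul_le_mul_of_nonneg_right (norm_trunc_le f n a) (norm_nonneg _)

variable (E) in
/-- The integral of a bounded function is the everywhere defined operator of the bounded
calculus. -/
theorem isIntegral_of_bdd (hf : IsBddMeas f) :
    E.IsIntegral f ((E.bcalc f : H →ₗ[ℂ] H).toPMap ⊤) := by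
  refine ⟨fun x => ⟨fun _ => ?_, fun _ => Submodule.mem_top⟩, fun x => E.inner_bcalc_self hf x⟩
  obtain ⟨c, hc⟩ := hf.bdd
  exact MemLp.of_bound hf.measurable.aestronglyMeasurable c (Eventually.of_forall hc)

/-! ### Push-forward of projection-valued measures -/

variable {β : Type*} [MeasurableSpace β]

/-- The push-forward of a projection-valued measure along a measurable map. -/
def map (E : ProjectionValuedMeasure α H) {k : α → β} (hk : Measurable k) :
    ProjectionValuedMeasure β H where
  proj s := E.proj (k ⁻¹' s)
  isStarProjection_proj s hs := E.isStarProjection_proj _ (hk hs)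
  proj_univ := E.proj_univ
  hasSum_proj_iUnion s hs hd x := by
    rw [Set.preimage_iUnion]
    exact E.hasSum_proj_iUnion _ (fun i => hk (hs i)) (fun i j hij => (hd hij).preimage k) x

theorem scalarMeasure_map {k : α → β} (hk : Measurable k) (x : H) :
    (E.map hk).scalarMeasure x = (E.scalarMeasure x).map k := by
  ext s hs
  rw [Measure.map_apply hk hs, scalarMeasure_apply _ _ hs, scalarMeasure_apply _ _ (hk hs)]
  rfl

theorem isIntegral_map_iff {k : α → β} (hk : Measurable k) {f : β → ℂ} (hf : Measurable f)
    {T : H →ₗ.[ℂ] H} : (E.map hk).IsIntegral f T ↔ E.IsIntegral (f ∘ k) T := by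
  unfold IsIntegral
  refine and_congr (forall_congr' fun x => ?_) (forall_congr' fun x => ?_)
  · rw [scalarMeasure_map, memLp_map_measure_iff hf.aestronglyMeasurable hk.aemeasurable]
  · rw [scalarMeasure_map, integral_map hk.aemeasurable hf.aestronglyMeasurable]
    rfl

theorem bcalc_map {k : α → β} (hk : Measurable k) {f : β → ℂ} (hf : IsBddMeas f) :
    (E.map hk).bcalc f = E.bcalc (f ∘ k) := by
  obtain ⟨c, hc⟩ := hf.bdd
  refine ext_of_inner_self fun x => ?_
  rw [inner_bcalc_self _ hf, inner_bcalc_self _ ⟨hf.measurable.comp hk, c, fun a => hc _⟩,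
    scalarMeasure_map, integral_map hk.aemeasurable hf.measurable.aestronglyMeasurable]
  rfl

end ProjectionValuedMeasure

/-! ### Intertwining and uniqueness of spectral measures -/

section

variable {H : Type*} [NormedAddCommGroup H] [InnerProductSpace ℂ H] [CompleteSpace H]

theorem isBddMeas_of_continuous {α : Type*} [TopologicalSpace α] [CompactSpace α]
    [MeasurableSpace α] [BorelSpace α] {f : α → ℂ} (hf : Continuous f) : IsBddMeas f := by
  obtain ⟨c, hc⟩ := isCompact_univ.exists_bound_of_continuousOn hf.continuousOn
  exact ⟨hf.measurable, c, fun x => hc x trivial⟩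

/-- On the unit interval, intertwining the first moments `∫ t dE` and `∫ t dF` intertwines the
projection-valued measures: pass to polynomials, to continuous functions by the Weierstrass
theorem, and to bounded Borel functions by the monotone class theorem. -/
theorem ProjectionValuedMeasure.intertwine_of_moment
    {E F : ProjectionValuedMeasure unitInterval H} {V : H →L[ℂ] H}
    (h : V * E.bcalc (fun t => ((t : ℝ) : ℂ)) = F.bcalc (fun t => ((t : ℝ) : ℂ)) * V)
    {s : Set unitInterval} (hs : MeasurableSet s) : V * E.proj s = F.proj s * V := by
  have hC := isBoundedClass_intertwine E F V
  have hid : IsBddMeas fun t : unitInterval => ((t : ℝ) : ℂ) :=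
    isBddMeas_of_continuous (by fun_prop)
  have hmono : ∀ n : ℕ, IsBddMeas (fun t : unitInterval => (((t : ℝ) ^ n : ℝ) : ℂ)) ∧
      V * E.bcalc (fun t => (((t : ℝ) ^ n : ℝ) : ℂ)) =
        F.bcalc (fun t => (((t : ℝ) ^ n : ℝ) : ℂ)) * V := by
    intro n
    refine ⟨isBddMeas_of_continuous (by fun_prop), ?_⟩
    induction n with
    | zero =>
      have h1 : (fun t : unitInterval => (((t : ℝ) ^ 0 : ℝ) : ℂ)) = 1 := by ext; simp
      rw [h1, E.bcalc_one, F.bcalc_one, mul_one, one_mul]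
    | succ n ih =>
      have h1 : (fun t : unitInterval => (((t : ℝ) ^ (n + 1) : ℝ) : ℂ)) =
          (fun t : unitInterval => (((t : ℝ) ^ n : ℝ) : ℂ)) *
            fun t : unitInterval => ((t : ℝ) : ℂ) := by
        ext; simp [pow_succ]
      have hb : IsBddMeas (fun t : unitInterval => (((t : ℝ) ^ n : ℝ) : ℂ)) :=
        isBddMeas_of_continuous (by fun_prop)
      rw [h1, E.bcalc_mul hb hid, F.bcalc_mul hb hid, ← mul_assoc, ih, mul_assoc, h, mul_assoc]
  have hpoly : ∀ p : Polynomial ℝ,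
      V * E.bcalc (fun t => ((p.eval (t : ℝ) : ℝ) : ℂ)) =
        F.bcalc (fun t => ((p.eval (t : ℝ) : ℝ) : ℂ)) * V := by
    have hb : ∀ p : Polynomial ℝ,
        IsBddMeas (fun t : unitInterval => ((p.eval (t : ℝ) : ℝ) : ℂ)) := fun p =>
      isBddMeas_of_continuous (by fun_prop)
    intro p
    induction p using Polynomial.induction_on' with
    | add p q hp hq =>
      have h1 := hC.add _ _ (hb p) (hb q) hp hq
      convert h1 using 3 <;> · ext; simp
    | monomial n a =>
      have h1 := hC.smul (a : ℂ) _ (hmono n).1 (hmono n).2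
      convert h1 using 3 <;> · ext; simp
  rw [← E.bcalc_indicator hs, ← F.bcalc_indicator hs]
  refine hC.of_continuous (fun f hf hf1 => ?_) (.indicator_one hs)
  have hex : ∀ n : ℕ, ∃ p : Polynomial ℝ, ∀ t : unitInterval,
      |p.eval (t : ℝ) - f t| < 1 / ((n : ℝ) + 1) := fun n => by
    obtain ⟨p, hp⟩ := exists_polynomial_near_of_continuousOn 0 1
      (Set.IccExtend zero_le_one f) (hf.Icc_extend' (h := zero_le_one)).continuousOn
      (1 / ((n : ℝ) + 1)) (by positivity)
    refine ⟨p, fun t => ?_⟩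
    have := hp t t.2
    rwa [Set.IccExtend_val] at this
  choose p hp using hex
  refine hC.lim (fun n t => (((p n).eval (t : ℝ) : ℝ) : ℂ)) _ 2
    (fun n => Continuous.measurable (by fun_prop)) (fun n t => ?_) (fun t => ?_)
    (fun n => hpoly (p n))
  · rw [Complex.norm_real, Real.norm_eq_abs]
    have h1 := abs_lt.1 (hp n t)
    have h2 : 1 / ((n : ℝ) + 1) ≤ 1 := by
      rw [div_le_one (by positivity)]
      linarith [(Nat.cast_nonneg n : (0 : ℝ) ≤ n)]
    have h3 := hf1 t
    exact abs_le.2 ⟨by linarith [h1.1], by linarith [h1.2]⟩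
  · refine (Complex.continuous_ofReal.tendsto _).comp ?_
    rw [tendsto_iff_norm_sub_tendsto_zero]
    exact squeeze_zero (fun n => norm_nonneg _) (fun n => (hp n t).le)
      tendsto_one_div_add_atTop_nhds_zero_nat

/-- The map `t ↦ 1 / (1 + t)` from `[0, ∞)` to `[0, 1]`. -/
def resolventMap (t : ℝ≥0) : unitInterval :=
  ⟨1 / (1 + (t : ℝ)), by positivity, by
    rw [div_le_one (by positivity)]
    linarith [t.2]⟩

/-- The left inverse `s ↦ 1 / s - 1` of `resolventMap`. At `s = 0`, which is not in the range of
`resolventMap`, the value is `0`. -/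
def resolventInv (s : unitInterval) : ℝ≥0 := Real.toNNReal (1 / (s : ℝ) - 1)

theorem measurable_resolventMap : Measurable resolventMap := by
  refine Measurable.subtype_mk ?_
  fun_prop

theorem measurable_resolventInv : Measurable resolventInv := by
  unfold resolventInv
  fun_prop

theorem resolventInv_resolventMap (t : ℝ≥0) : resolventInv (resolventMap t) = t := by
  simp [resolventInv, resolventMap]

/-- The function `t ↦ 1 / (1 + t)` with complex values, whose integral is `(1 + A)⁻¹` for
`A = ∫ t dE`. -/
def resolventFun (t : ℝ≥0) : ℂ := ((resolventMap t : ℝ) : ℂ)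

theorem isBddMeas_resolventFun : IsBddMeas resolventFun :=
  ⟨Complex.measurable_ofReal.comp (measurable_subtype_coe.comp measurable_resolventMap), 1,
    fun t => by
      rw [resolventFun, Complex.norm_real, Real.norm_of_nonneg (resolventMap t).2.1]
      exact (resolventMap t).2.2⟩

theorem resolventFun_mul_add (t : ℝ≥0) :
    resolventFun t * ((t : ℝ) : ℂ) + resolventFun t = 1 := by
  have h : (1 + (t : ℝ)) ≠ 0 := by positivity
  have : ((resolventMap t : ℝ)) * t + resolventMap t = 1 := by
    simp only [resolventMap]
    field_simp
    ring
  unfold resolventFun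
  exact_mod_cast this

theorem isBddMeas_resolventFun_mul :
    IsBddMeas (resolventFun * fun t : ℝ≥0 => ((t : ℝ) : ℂ)) := by
  have : resolventFun * (fun t : ℝ≥0 => ((t : ℝ) : ℂ)) = 1 - resolventFun := by
    ext t
    rw [Pi.mul_apply, Pi.sub_apply, Pi.one_apply, ← resolventFun_mul_add t]
    ring
  rw [this]
  exact IsBddMeas.one.sub isBddMeas_resolventFun

/-- The case of the half-line follows from that of the unit interval, as `resolventMap` is
injective. -/
theorem ProjectionValuedMeasure.intertwine_of_resolvent
    {E F : ProjectionValuedMeasure ℝ≥0 H} {V : H →L[ℂ] H}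
    (h : V * E.bcalc resolventFun = F.bcalc resolventFun * V)
    {s : Set ℝ≥0} (hs : MeasurableSet s) : V * E.proj s = F.proj s * V := by
  have hb : IsBddMeas fun t : unitInterval => ((t : ℝ) : ℂ) :=
    isBddMeas_of_continuous (by fun_prop)
  have h1 : V * (E.map measurable_resolventMap).bcalc (fun t => ((t : ℝ) : ℂ)) =
      (F.map measurable_resolventMap).bcalc (fun t => ((t : ℝ) : ℂ)) * V := by
    rw [bcalc_map _ hb, bcalc_map _ hb]
    exact h
  have h2 := intertwine_of_moment h1 (measurable_resolventInv hs)
  have h3 : resolventMap ⁻¹' (resolventInv ⁻¹' s) = s := by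
    ext t
    simp [resolventInv_resolventMap]
  have h4 : ∀ E : ProjectionValuedMeasure ℝ≥0 H,
      (E.map measurable_resolventMap).proj (resolventInv ⁻¹' s) = E.proj s := fun E =>
    congrArg E.proj h3
  rwa [h4, h4] at h2

theorem measurable_coe_nnreal_complex : Measurable fun t : ℝ≥0 => ((t : ℝ) : ℂ) := by fun_prop

namespace IsSpectralMeasure

variable {A B : H →ₗ.[ℂ] H} {E F : ProjectionValuedMeasure ℝ≥0 H}

/-- `(1 + A)⁻¹ (A + 1) = 1` on the domain of `A`. -/
theorem bcalc_resolventFun_apply (hE : IsSpectralMeasure A E) (x : A.domain) :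
    E.bcalc resolventFun (A x + x) = x := by
  rw [map_add, ProjectionValuedMeasure.IsIntegral.bcalc_apply measurable_coe_nnreal_complex hE
    isBddMeas_resolventFun isBddMeas_resolventFun_mul, ← _root_.add_apply,
    ← E.bcalc_add isBddMeas_resolventFun_mul isBddMeas_resolventFun]
  have : (resolventFun * fun t : ℝ≥0 => ((t : ℝ) : ℂ)) + resolventFun = 1 :=
    funext resolventFun_mul_add
  rw [this, E.bcalc_one]
  rfl

/-- `(A + 1) (1 + A)⁻¹ = 1`. -/
theorem apply_bcalc_resolventFun (hE : IsSpectralMeasure A E) (y : H) :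
    ∃ h : E.bcalc resolventFun y ∈ A.domain,
      A ⟨E.bcalc resolventFun y, h⟩ + E.bcalc resolventFun y = y := by
  have hb := isBddMeas_resolventFun_mul
  have hc : (fun t : ℝ≥0 => ((t : ℝ) : ℂ)) * resolventFun =
    resolventFun * fun t : ℝ≥0 => ((t : ℝ) : ℂ) := mul_comm _ _
  obtain ⟨h, h'⟩ := ProjectionValuedMeasure.IsIntegral.apply_bcalc measurable_coe_nnreal_complex
    hE isBddMeas_resolventFun (by rwa [hc]) y
  refine ⟨h, ?_⟩
  rw [h', hc, ← _root_.add_apply,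
    ← E.bcalc_add isBddMeas_resolventFun_mul isBddMeas_resolventFun]
  have : (resolventFun * fun t : ℝ≥0 => ((t : ℝ) : ℂ)) + resolventFun = 1 :=
    funext resolventFun_mul_add
  rw [this, E.bcalc_one]
  rfl

/-- If `V A ⊆ B V`, then `V` intertwines the spectral projections of `A` and `B`. -/
theorem intertwine (hE : IsSpectralMeasure A E) (hF : IsSpectralMeasure B F) {V : H →L[ℂ] H}
    (hV : ∀ x : A.domain, ∃ h : V x ∈ B.domain, B ⟨V x, h⟩ = V (A x))
    {s : Set ℝ≥0} (hs : MeasurableSet s) : V * E.proj s = F.proj s * V := by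
  refine ProjectionValuedMeasure.intertwine_of_resolvent ?_ hs
  ext y
  obtain ⟨h, h'⟩ := hE.apply_bcalc_resolventFun y
  obtain ⟨hV1, hV2⟩ := hV ⟨_, h⟩
  have h1 := hF.bcalc_resolventFun_apply ⟨_, hV1⟩
  rw [hV2, ← map_add, h'] at h1
  exact h1.symm

/-- The spectral measure is unique: intertwine with `V = 1`. -/
theorem proj_eq (hE : IsSpectralMeasure A E) (hF : IsSpectralMeasure A F) {s : Set ℝ≥0}
    (hs : MeasurableSet s) : E.proj s = F.proj s := by
  have := hE.intertwine hF (V := 1) (fun x => ⟨x.2, rfl⟩) hs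
  rwa [one_mul, mul_one] at this

theorem spectralMeasure (hE : IsSpectralMeasure A E) :
    IsSpectralMeasure A (spectralMeasure A) := by
  have h : ∃ E, IsSpectralMeasure A E := ⟨E, hE⟩
  rw [NCLorentz.spectralMeasure, dif_pos h]
  exact h.choose_spec

theorem spectralProj_eq (hE : IsSpectralMeasure A E) {s : Set ℝ≥0} (hs : MeasurableSet s) :
    spectralProj A s = E.proj s :=
  hE.spectralMeasure.proj_eq hE hs

end IsSpectralMeasure

end

/-! ### The spectral theorem for a bounded operator with spectrum in the unit interval -/

section

variable {H : Type*} [NormedAddCommGroup H] [InnerProductSpace ℂ H] [CompleteSpace H]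

namespace HasBoundedCalc

variable {α : Type*} [MeasurableSpace α] {μ : H → Measure α}

omit [CompleteSpace H] in
theorem inner_calc_indicator (hμ : HasBoundedCalc μ) {s : Set α} (hs : MeasurableSet s) (x : H) :
    ⟪x, boundedCalc μ (s.indicator 1) x⟫_ℂ = ((μ x).real s : ℂ) := by
  rw [hμ.represents (.indicator_one hs), integral_indicator hs]
  simp

theorem isStarProjection_calc_indicator (hμ : HasBoundedCalc μ)
    (hmul : ∀ f g, IsBddMeas f → IsBddMeas g →
      boundedCalc μ (f * g) = boundedCalc μ f * boundedCalc μ g)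
    {s : Set α} (hs : MeasurableSet s) :
    IsStarProjection (boundedCalc μ (s.indicator (1 : α → ℂ))) := by
  have hi := IsBddMeas.indicator_one (α := α) hs
  refine ⟨?_, ?_⟩
  · rw [IsIdempotentElem, ← hmul _ _ hi hi]
    congr 1
    rw [← Set.inter_indicator_one, Set.inter_self]
  · rw [isSelfAdjoint_iff, ← hμ.calc_star hi]
    congr 1
    ext a
    by_cases ha : a ∈ s <;> simp [ha]

theorem norm_sq_calc_indicator (hμ : HasBoundedCalc μ)
    (hmul : ∀ f g, IsBddMeas f → IsBddMeas g →
      boundedCalc μ (f * g) = boundedCalc μ f * boundedCalc μ g)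
    {s : Set α} (hs : MeasurableSet s) (x : H) :
    ‖boundedCalc μ (s.indicator (1 : α → ℂ)) x‖ ^ 2 = (μ x).real s := by
  have h := hμ.isStarProjection_calc_indicator hmul hs
  set P := boundedCalc μ (s.indicator (1 : α → ℂ)) with hP
  have h1 : P x = P (P x) := by rw [← mul_apply_eq_comp, h.isIdempotentElem.eq]
  have h2 : ContinuousLinearMap.adjoint P = P := by
    rw [← ContinuousLinearMap.star_eq_adjoint, h.isSelfAdjoint.star_eq]
  have h3 := hμ.inner_calc_indicator hs x
  rw [← hP, h1, ← ContinuousLinearMap.adjoint_inner_left, h2, inner_self_eq_norm_sq_to_K] at h3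
  exact Complex.ofReal_injective (by rw [← h3]; simp)

/-- A family of measures with a multiplicative and unital bounded calculus comes from a
projection-valued measure. -/
def toPVM (hμ : HasBoundedCalc μ)
    (hmul : ∀ f g, IsBddMeas f → IsBddMeas g →
      boundedCalc μ (f * g) = boundedCalc μ f * boundedCalc μ g)
    (hone : boundedCalc μ 1 = 1) : ProjectionValuedMeasure α H where
  proj s := boundedCalc μ (s.indicator 1)
  isStarProjection_proj _ hs := hμ.isStarProjection_calc_indicator hmul hs
  proj_univ := by rw [Set.indicator_univ, hone]
  hasSum_proj_iUnion s hs hd x := by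
    have := hμ.bdd.isFiniteMeasure x
    have hm : ∀ F : Finset ℕ, MeasurableSet (⋃ i ∈ F, s i) := fun F =>
      Finset.measurableSet_biUnion _ fun i _ => hs i
    have hU := MeasurableSet.iUnion hs
    have hsum : ∀ F : Finset ℕ, ∑ i ∈ F, boundedCalc μ ((s i).indicator 1) x =
        boundedCalc μ ((⋃ i ∈ F, s i).indicator 1) x := by
      intro F
      induction F using Finset.induction_on with
      | empty =>
        have h0 := hμ.norm_sq_calc_indicator hmul MeasurableSet.empty x
        simp only [measureReal_empty, ne_eq, OfNat.ofNat_ne_zero, not_false_eq_true,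
          pow_eq_zero_iff, norm_eq_zero] at h0
        simp only [Finset.sum_empty, Finset.notMem_empty, Set.iUnion_of_empty, Set.iUnion_empty]
        exact h0.symm
      | insert i F hi ih =>
        have hdis : Disjoint (s i) (⋃ j ∈ F, s j) := by
          simp only [Set.disjoint_iUnion_right]
          intro j hj
          exact hd (by rintro rfl; exact hi hj)
        have hun : ((s i) ∪ ⋃ j ∈ F, s j).indicator (1 : α → ℂ) =
            (s i).indicator 1 + (⋃ j ∈ F, s j).indicator 1 :=
          Set.indicator_union_of_disjoint hdis _
        rw [Finset.sum_insert hi, ih, Finset.set_biUnion_insert, hun,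
          hμ.calc_add (.indicator_one (hs i)) (.indicator_one (hm F))]
        rfl
    -- the remainder is the projection of `(⋃ i, s i) \ ⋃ i ∈ F, s i`, whose measure tends to `0`
    have hdiff : ∀ F : Finset ℕ, ‖∑ i ∈ F, boundedCalc μ ((s i).indicator 1) x -
        boundedCalc μ ((⋃ i, s i).indicator 1) x‖ =
        √((μ x).real ((⋃ i, s i) \ ⋃ i ∈ F, s i)) := by
      intro F
      have hsub : (⋃ i ∈ F, s i) ⊆ ⋃ i, s i := Set.iUnion₂_subset_iUnion _ _
      have hun : (⋃ i, s i).indicator (1 : α → ℂ) =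
          ((⋃ i, s i) \ ⋃ i ∈ F, s i).indicator 1 + (⋃ i ∈ F, s i).indicator 1 := by
        have := Set.indicator_union_of_disjoint (M := ℂ)
          (Set.disjoint_sdiff_left (s := ⋃ i ∈ F, s i) (t := ⋃ i, s i)) 1
        rw [Set.sdiff_union_of_subset hsub] at this
        exact this
      rw [hsum, hun, hμ.calc_add (.indicator_one (hU.diff (hm F))) (.indicator_one (hm F)),
        ← hμ.norm_sq_calc_indicator hmul (hU.diff (hm F)), Real.sqrt_sq (norm_nonneg _),
        ← norm_neg]
      simp
    rw [HasSum, SummationFilter.unconditional_filter, tendsto_iff_norm_sub_tendsto_zero]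
    simp_rw [hdiff]
    have hlim : Tendsto (fun F : Finset ℕ => μ x ((⋃ i, s i) \ ⋃ i ∈ F, s i)) atTop (𝓝 0) := by
      have h1 := tendsto_measure_iInter_atTop (μ := μ x)
        (s := fun F : Finset ℕ => (⋃ i, s i) \ ⋃ i ∈ F, s i)
        (fun F => (hU.diff (hm F)).nullMeasurableSet)
        (fun F G hFG => Set.sdiff_subset_sdiff_right (Set.biUnion_subset_biUnion_left hFG))
        ⟨∅, measure_ne_top _ _⟩
      have h2 : ⋂ F : Finset ℕ, ((⋃ i, s i) \ ⋃ i ∈ F, s i) = ∅ := by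
        ext a
        simp only [Set.mem_iInter, Set.mem_sdiff, Set.mem_iUnion, Set.mem_empty_iff_false,
          iff_false]
        intro h
        obtain ⟨i, hi⟩ := (h ∅).1
        exact (h {i}).2 ⟨i, by simp, hi⟩
      rwa [h2, measure_empty] at h1
    have h3 := ((ENNReal.tendsto_toReal ENNReal.zero_ne_top).comp hlim).sqrt
    rw [ENNReal.toReal_zero, Real.sqrt_zero] at h3
    exact h3

theorem scalarMeasure_toPVM (hμ : HasBoundedCalc μ)
    (hmul : ∀ f g, IsBddMeas f → IsBddMeas g →
      boundedCalc μ (f * g) = boundedCalc μ f * boundedCalc μ g)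
    (hone : boundedCalc μ 1 = 1) : (hμ.toPVM hmul hone).scalarMeasure = μ := by
  ext x s hs
  have := hμ.bdd.isFiniteMeasure x
  rw [ProjectionValuedMeasure.scalarMeasure_apply' _ _ hs]
  change ENNReal.ofReal (‖boundedCalc μ (s.indicator 1) x‖ ^ 2) = _
  rw [hμ.norm_sq_calc_indicator hmul hs, ofReal_measureReal]

/-- Multiplicativity extends from continuous to bounded Borel functions, one factor at a time. -/
theorem calc_mul_of_continuous {α : Type*} [PseudoMetricSpace α] [CompactSpace α]
    [MeasurableSpace α] [BorelSpace α] {μ : H → Measure α} (hμ : HasBoundedCalc μ)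
    (h : ∀ f g : α → ℝ, Continuous f → Continuous g →
      boundedCalc μ ((fun x => (f x : ℂ)) * fun x => (g x : ℂ)) =
        boundedCalc μ (fun x => (f x : ℂ)) * boundedCalc μ (fun x => (g x : ℂ)))
    {f g : α → ℂ} (hf : IsBddMeas f) (hg : IsBddMeas g) :
    boundedCalc μ (f * g) = boundedCalc μ f * boundedCalc μ g := by
  refine (hμ.isBoundedClass_mul_left hf).of_continuous (fun g' hg' _ => ?_) hg
  refine (hμ.isBoundedClass_mul_right (isBddMeas_of_continuous (by fun_prop))).of_continuous
    (fun f' hf' _ => ?_) hf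
  exact h f' g' hf' hg'

end HasBoundedCalc

/-- The continuous functional calculus of an operator on functions on the unit interval. The
function is extended to `ℝ` by constants, which is immaterial when the spectrum lies in `[0, 1]`. -/
def unitCfc (B : H →L[ℂ] H) (f : unitInterval → ℝ) : H →L[ℂ] H :=
  cfc (Set.IccExtend zero_le_one f) B

section

variable {B : H →L[ℂ] H} {f g : unitInterval → ℝ}

theorem continuousOn_IccExtend (hf : Continuous f) (s : Set ℝ) :
    ContinuousOn (Set.IccExtend zero_le_one f) s :=
  (hf.Icc_extend' (h := zero_le_one)).continuousOn

theorem unitCfc_add (hf : Continuous f) (hg : Continuous g) :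
    unitCfc B (fun t => f t + g t) = unitCfc B f + unitCfc B g :=
  cfc_add B _ _ (continuousOn_IccExtend hf _) (continuousOn_IccExtend hg _)

theorem unitCfc_mul (hf : Continuous f) (hg : Continuous g) :
    unitCfc B (fun t => f t * g t) = unitCfc B f * unitCfc B g :=
  cfc_mul _ _ B (continuousOn_IccExtend hf _) (continuousOn_IccExtend hg _)

theorem unitCfc_smul (c : ℝ) (hf : Continuous f) :
    unitCfc B (fun t => c * f t) = c • unitCfc B f :=
  cfc_smul c _ B (continuousOn_IccExtend hf _)

theorem unitCfc_one (hB : IsSelfAdjoint B) : unitCfc B (fun _ => 1) = 1 :=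
  cfc_one ℝ B hB

theorem unitCfc_id (hB : IsSelfAdjoint B) (hs : spectrum ℝ B ⊆ Set.Icc 0 1) :
    unitCfc B (fun t => (t : ℝ)) = B := by
  conv_rhs => rw [← cfc_id ℝ B hB]
  refine cfc_congr fun t ht => ?_
  rw [Set.IccExtend_of_mem _ _ (hs ht)]
  rfl

theorem isPositive_unitCfc (hf : ∀ t, 0 ≤ f t) : (unitCfc B f).IsPositive := by
  rw [← ContinuousLinearMap.nonneg_iff_isPositive]
  exact cfc_nonneg fun t _ => hf _

theorem isSelfAdjoint_unitCfc : IsSelfAdjoint (unitCfc B f) := cfc_predicate _ _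

theorem inner_unitCfc_eq_re (x : H) :
    ⟪x, unitCfc B f x⟫_ℂ = ((⟪x, unitCfc B f x⟫_ℂ).re : ℂ) := by
  have h : (starRingEnd ℂ) ⟪x, unitCfc B f x⟫_ℂ = ⟪x, unitCfc B f x⟫_ℂ := by
    rw [inner_conj_symm, ← ContinuousLinearMap.adjoint_inner_right,
      ← ContinuousLinearMap.star_eq_adjoint, isSelfAdjoint_unitCfc.star_eq]
  exact (Complex.conj_eq_iff_re.1 h).symm

variable (B) in
/-- The positive functional `f ↦ ⟪x, f(B) x⟫`. -/
def momentFunctional (x : H) : CompactlySupportedContinuousMap unitInterval ℝ →ₚ[ℝ] ℝ :=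
  PositiveLinearMap.mk₀
    { toFun := fun f => (⟪x, unitCfc B f x⟫_ℂ).re
      map_add' := fun f g => by
        have h := unitCfc_add (B := B) f.continuous g.continuous
        have h' : unitCfc B ⇑(f + g) = unitCfc B f + unitCfc B g := h
        rw [h', _root_.add_apply, inner_add_right, Complex.add_re]
      map_smul' := fun c f => by
        have h := unitCfc_smul (B := B) c f.continuous
        have h' : unitCfc B ⇑(c • f) = c • unitCfc B f := h
        rw [h', _root_.smul_apply, RingHom.id_apply, ← Complex.coe_smul, inner_smul_right,
          Complex.re_ofReal_mul, smul_eq_mul] }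
    (fun f hf => by
      have := (isPositive_unitCfc (B := B) (f := f) hf).re_inner_nonneg_right x
      simpa using this)

variable (B) in
/-- The measure of the functional `f ↦ ⟪x, f(B) x⟫`. -/
def momentMeasure (x : H) : Measure unitInterval :=
  RealRMK.rieszMeasure (momentFunctional B x)

instance (x : H) : IsFiniteMeasure (momentMeasure B x) := by
  unfold momentMeasure
  infer_instance

theorem represents_momentMeasure (hf : Continuous f) :
    Represents (momentMeasure B) (fun t => (f t : ℂ)) (unitCfc B f) := fun x => by
  have h := RealRMK.integral_rieszMeasure (momentFunctional B x)
    ⟨⟨f, hf⟩, HasCompactSupport.of_compactSpace f⟩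
  rw [integral_complex_ofReal, inner_unitCfc_eq_re]
  exact congrArg _ h.symm

theorem isQuadraticallyBounded_momentMeasure (hB : IsSelfAdjoint B) :
    IsQuadraticallyBounded (momentMeasure B) := fun x => by
  have h := represents_momentMeasure (B := B) (f := fun _ => 1) continuous_const x
  rw [unitCfc_one hB, integral_complex_ofReal, one_apply_eq_self, inner_self_eq_norm_sq_to_K] at h
  have h1 : ‖x‖ ^ 2 = (momentMeasure B x).real Set.univ := by
    refine Complex.ofReal_injective (Eq.trans ?_ (h.trans ?_)) <;> simp
  rw [h1, ofReal_measureReal]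

end

/-- The spectral theorem: a self-adjoint operator with spectrum in `[0, 1]` is the first moment of
a projection-valued measure on `[0, 1]`. -/
theorem exists_pvm_of_spectrum_subset {B : H →L[ℂ] H} (hB : IsSelfAdjoint B)
    (hs : spectrum ℝ B ⊆ Set.Icc 0 1) :
    ∃ E : ProjectionValuedMeasure unitInterval H, E.bcalc (fun t => ((t : ℝ) : ℂ)) = B := by
  have hbdd := isQuadraticallyBounded_momentMeasure hB
  have hμ : HasBoundedCalc (momentMeasure B) := ⟨hbdd, fun f hf =>
    (isBoundedClass_represented hbdd).of_continuous
      (fun f hf _ => ⟨_, represents_momentMeasure hf⟩) hf⟩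
  have hmul : ∀ f g, IsBddMeas f → IsBddMeas g → boundedCalc (momentMeasure B) (f * g) =
      boundedCalc (momentMeasure B) f * boundedCalc (momentMeasure B) g := fun f g =>
    hμ.calc_mul_of_continuous fun f g hf hg => by
      have h1 := represents_momentMeasure (B := B) (f := fun t => f t * g t) (hf.mul hg)
      have h2 : (fun t => ((f t * g t : ℝ) : ℂ)) = (fun x => (f x : ℂ)) * fun x => (g x : ℂ) := by
        ext; simp
      rw [h2] at h1
      rw [h1.boundedCalc_eq, (represents_momentMeasure hf).boundedCalc_eq,
        (represents_momentMeasure hg).boundedCalc_eq, unitCfc_mul hf hg]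
  have hone : boundedCalc (momentMeasure B) 1 = 1 := by
    have h1 := represents_momentMeasure (B := B) (f := fun _ => 1) continuous_const
    rw [unitCfc_one hB] at h1
    have h2 : (fun _ : unitInterval => ((1 : ℝ) : ℂ)) = 1 := by ext; simp
    rw [h2] at h1
    exact h1.boundedCalc_eq
  refine ⟨hμ.toPVM hmul hone, ?_⟩
  rw [ProjectionValuedMeasure.bcalc, hμ.scalarMeasure_toPVM,
    (represents_momentMeasure (f := fun t => (t : ℝ)) (by fun_prop)).boundedCalc_eq,
    unitCfc_id hB hs]

end

/-! ### The operator `L* L` and its spectral measure -/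

section

variable {H : Type*} [NormedAddCommGroup H] [InnerProductSpace ℂ H] [CompleteSpace H]

omit [CompleteSpace H] in
theorem mem_compOp_domain {S T : H →ₗ.[ℂ] H} {x : H} :
    x ∈ (compOp S T).domain ↔ ∃ h : x ∈ T.domain, T ⟨x, h⟩ ∈ S.domain := by
  constructor
  · rintro ⟨⟨y, hy, rfl⟩, hx⟩
    exact ⟨hx, hy⟩
  · rintro ⟨h, h'⟩
    exact ⟨⟨⟨x, h⟩, h', rfl⟩, h⟩

omit [CompleteSpace H] in
theorem compOp_apply {S T : H →ₗ.[ℂ] H} {x : H} (hx : x ∈ (compOp S T).domain)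
    (h : x ∈ T.domain) (h' : T ⟨x, h⟩ ∈ S.domain) : compOp S T ⟨x, hx⟩ = S ⟨T ⟨x, h⟩, h'⟩ :=
  rfl

/-- `R` is the inverse of `1 + A`, so that the range of `R` is the domain of `A`. -/
structure IsResolvent (A : H →ₗ.[ℂ] H) (R : H →L[ℂ] H) : Prop where
  left_inv : ∀ x : A.domain, R (A x + x) = x
  right_inv : ∀ y, ∃ h : R y ∈ A.domain, A ⟨R y, h⟩ + R y = y

omit [CompleteSpace H] in
theorem IsResolvent.ext {A B : H →ₗ.[ℂ] H} {R : H →L[ℂ] H} (hA : IsResolvent A R)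
    (hB : IsResolvent B R) : A = B := by
  have key : ∀ {A B : H →ₗ.[ℂ] H}, IsResolvent A R → IsResolvent B R → ∀ x : A.domain,
      ∃ h : (x : H) ∈ B.domain, B ⟨x, h⟩ = A x := by
    intro A B hA hB x
    obtain ⟨h, h'⟩ := hB.right_inv (A x + x)
    simp only [hA.left_inv x] at h h'
    exact ⟨h, add_right_cancel h'⟩
  refine LinearPMap.ext (Submodule.ext fun x => ⟨fun h => (key hA hB ⟨x, h⟩).1,
    fun h => (key hB hA ⟨x, h⟩).1⟩) fun x h1 h2 => ?_
  exact (key hA hB ⟨x, h1⟩).2.symm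

theorem IsSpectralMeasure.isResolvent {A : H →ₗ.[ℂ] H} {E : ProjectionValuedMeasure ℝ≥0 H}
    (hE : IsSpectralMeasure A E) : IsResolvent A (E.bcalc resolventFun) :=
  ⟨hE.bcalc_resolventFun_apply, hE.apply_bcalc_resolventFun⟩

variable {L : H →ₗ.[ℂ] H}

/-- The weak form of `(1 + L* L) R y = y`: take for `R y` the first component of the orthogonal
projection of `(y, 0)` onto the graph of `L`. -/
theorem exists_graph_projection (hc : L.IsClosed) :
    ∃ R : H →L[ℂ] H, ∀ y, ∃ h : R y ∈ L.domain, ∀ u : L.domain,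
      ⟪(u : H), y - R y⟫_ℂ = ⟪L u, L ⟨R y, h⟩⟫_ℂ := by
  let e := WithLp.prodContinuousLinearEquiv 2 ℂ H H
  let K : Submodule ℂ (WithLp 2 (H × H)) := L.graph.comap (e : WithLp 2 (H × H) →ₗ[ℂ] H × H)
  have hK : _root_.IsClosed (K : Set (WithLp 2 (H × H))) := IsClosed.preimage e.continuous hc
  have : CompleteSpace K := hK.completeSpace_coe
  let R : H →L[ℂ] H := (ContinuousLinearMap.fst ℂ H H).comp
    ((e : WithLp 2 (H × H) →L[ℂ] H × H).comp (K.starProjection.comp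
      ((e.symm : H × H →L[ℂ] WithLp 2 (H × H)).comp (ContinuousLinearMap.inl ℂ H H))))
  refine ⟨R, fun y => ?_⟩
  set w : WithLp 2 (H × H) := K.starProjection (e.symm (y, 0)) with hw
  have hR : R y = w.ofLp.1 := rfl
  have hwK : w.ofLp ∈ L.graph := by
    have : w ∈ K := Submodule.starProjection_apply_mem _ _
    exact this
  obtain ⟨x, hx1, hx2⟩ := (L.mem_graph_iff).1 hwK
  have hd : R y ∈ L.domain := by
    rw [hR, ← hx1]
    exact x.2
  have hL : L ⟨R y, hd⟩ = w.ofLp.2 := by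
    rw [← hx2]
    congr 1
    exact Subtype.ext hx1.symm
  refine ⟨hd, fun u => ?_⟩
  have hu : e.symm ((u : H), L u) ∈ K := L.mem_graph u
  have h := K.starProjection_inner_eq_zero (e.symm (y, 0)) _ hu
  rw [← hw, WithLp.prod_inner_apply] at h
  have h' : ⟪y - R y, (u : H)⟫_ℂ + ⟪0 - L ⟨R y, hd⟩, L u⟫_ℂ = 0 := by
    rw [hL, hR]
    exact h
  rw [zero_sub, inner_neg_left, ← sub_eq_add_neg, sub_eq_zero] at h'
  rw [← inner_conj_symm, h', inner_conj_symm]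

/-- Von Neumann's theorem: `1 + L* L` is invertible, with inverse `R` satisfying `0 ≤ R ≤ 1`. -/
theorem exists_isResolvent_adjoint_comp (hd : Dense (L.domain : Set H)) (hc : L.IsClosed) :
    ∃ R : H →L[ℂ] H, IsResolvent (compOp L.adjoint L) R ∧ R.IsPositive ∧ ‖R‖ ≤ 1 ∧
      ∀ y, R y = 0 → y = 0 := by
  obtain ⟨R, hR⟩ := exists_graph_projection hc
  have hadj : ∀ y (h : R y ∈ L.domain), ∃ h' : L ⟨R y, h⟩ ∈ L.adjoint.domain,
      L.adjoint ⟨L ⟨R y, h⟩, h'⟩ = y - R y := by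
    intro y h
    have h1 : ∀ u : L.domain, ⟪y - R y, (u : H)⟫_ℂ = ⟪L ⟨R y, h⟩, L u⟫_ℂ := fun u => by
      obtain ⟨h2, h3⟩ := hR y
      rw [← inner_conj_symm, h3 u, inner_conj_symm]
    exact ⟨LinearPMap.mem_adjoint_domain_of_exists _ ⟨_, h1⟩,
      LinearPMap.adjoint_apply_eq hd _ h1⟩
  have hself : ∀ y, ∃ h : R y ∈ L.domain,
      ⟪R y, y⟫_ℂ = ((‖R y‖ ^ 2 + ‖L ⟨R y, h⟩‖ ^ 2 : ℝ) : ℂ) := by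
    intro y
    obtain ⟨h, h'⟩ := hR y
    refine ⟨h, ?_⟩
    have h1 := h' ⟨R y, h⟩
    rw [inner_sub_right, sub_eq_iff_eq_add, inner_self_eq_norm_sq_to_K,
      inner_self_eq_norm_sq_to_K] at h1
    rw [h1]
    push_cast
    exact add_comm _ _
  refine ⟨R, ⟨fun x => ?_, fun y => ?_⟩, ?_, ?_, ?_⟩
  · obtain ⟨hx, hx'⟩ := mem_compOp_domain.1 x.2
    set y := compOp L.adjoint L x + x with hy
    have hxa : compOp L.adjoint L x = L.adjoint ⟨L ⟨x, hx⟩, hx'⟩ := rfl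
    obtain ⟨h, h'⟩ := hR y
    -- the difference `z = R y - x` satisfies `(1 + L* L) z = 0`
    have h0 : ∀ u : L.domain, ⟪L u, L ⟨R y, h⟩ - L ⟨x, hx⟩⟫_ℂ = ⟪(u : H), (x : H) - R y⟫_ℂ := by
      intro u
      have h1 := LinearPMap.adjoint_isFormalAdjoint hd ⟨L ⟨x, hx⟩, hx'⟩ u
      rw [inner_sub_right, ← h' u, ← inner_conj_symm (L u), ← h1, inner_conj_symm, ← hxa,
        ← inner_sub_right]
      congr 1
      rw [hy]
      abel
    have h1 := h0 (⟨R y, h⟩ - ⟨x, hx⟩)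
    rw [LinearPMap.map_sub, inner_self_eq_norm_sq_to_K, Submodule.coe_sub,
      ← neg_sub (R y) (x : H), inner_neg_right, inner_self_eq_norm_sq_to_K] at h1
    have h2 : ‖L ⟨R y, h⟩ - L ⟨x, hx⟩‖ ^ 2 = -‖R y - x‖ ^ 2 := by exact_mod_cast h1
    have h3 : ‖R y - x‖ = 0 := by
      nlinarith [sq_nonneg ‖L ⟨R y, h⟩ - L ⟨x, hx⟩‖, norm_nonneg (R y - x)]
    exact sub_eq_zero.1 (norm_eq_zero.1 h3)
  · obtain ⟨h, -⟩ := hR y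
    obtain ⟨h', h''⟩ := hadj y h
    refine ⟨mem_compOp_domain.2 ⟨h, h'⟩, ?_⟩
    rw [compOp_apply _ h h', h'']
    abel
  · rw [ContinuousLinearMap.isPositive_iff_complex]
    intro y
    obtain ⟨h, h'⟩ := hself y
    rw [h']
    exact ⟨rfl, by rw [RCLike.re_eq_complex_re, Complex.ofReal_re]; positivity⟩
  · refine R.opNorm_le_bound zero_le_one fun y => ?_
    obtain ⟨h, h'⟩ := hself y
    have h1 : ‖R y‖ ^ 2 ≤ ‖R y‖ * ‖y‖ := by
      calc ‖R y‖ ^ 2 ≤ ‖R y‖ ^ 2 + ‖L ⟨R y, h⟩‖ ^ 2 := le_add_of_nonneg_right (by positivity)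
        _ = ‖⟪R y, y⟫_ℂ‖ := by
          rw [h', Complex.norm_real, Real.norm_of_nonneg (by positivity)]
        _ ≤ _ := norm_inner_le_norm _ _
    rw [one_mul]
    by_contra! hlt
    nlinarith [norm_nonneg y]
  · intro y hy
    obtain ⟨h, h'⟩ := hR y
    refine hd.eq_zero_of_inner_right ℂ fun u hu => ?_
    have h1 := h' ⟨u, hu⟩
    have h2 : L ⟨R y, h⟩ = 0 := by
      have : (⟨R y, h⟩ : L.domain) = 0 := Subtype.ext hy
      rw [this, LinearPMap.map_zero]
    rwa [h2, hy, sub_zero, inner_zero_right] at h1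

theorem ProjectionValuedMeasure.bcalc_congr {α : Type*} [MeasurableSpace α]
    {E : ProjectionValuedMeasure α H} {f g : α → ℂ} (hf : IsBddMeas f) (hg : IsBddMeas g)
    {s : Set α} (hs : MeasurableSet s) (h0 : E.proj s = 0) (h : ∀ a ∉ s, f a = g a) :
    E.bcalc f = E.bcalc g := by
  refine ext_of_inner_self fun x => ?_
  rw [E.inner_bcalc_self hf, E.inner_bcalc_self hg]
  refine integral_congr_ae ?_
  have h1 : E.scalarMeasure x s = 0 := by
    rw [E.scalarMeasure_apply' x hs, h0]
    simp
  filter_upwards [measure_eq_zero_iff_ae_notMem.1 h1] with a ha using h a ha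

/-- An operator with a resolvent `0 ≤ R ≤ 1` has a spectral measure, namely the image of that of
`R` under `s ↦ 1 / s - 1`. The point `0` is not charged because `R` is injective. -/
theorem exists_isSpectralMeasure_of_isResolvent {A : H →ₗ.[ℂ] H} {R : H →L[ℂ] H}
    (hA : IsResolvent A R) (hpos : R.IsPositive) (hnorm : ‖R‖ ≤ 1)
    (hinj : ∀ y, R y = 0 → y = 0) :
    ∃ E : ProjectionValuedMeasure ℝ≥0 H, IsSpectralMeasure A E := by
  have hspec : spectrum ℝ R ⊆ Set.Icc 0 1 := by
    intro t ht
    refine ⟨spectrum_nonneg_of_nonneg ((ContinuousLinearMap.nonneg_iff_isPositive R).2 hpos) ht,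
      ?_⟩
    refine (le_abs_self t).trans ((spectrum.norm_le_norm_mul_of_mem ht).trans ?_)
    exact mul_le_one₀ hnorm (norm_nonneg _) ContinuousLinearMap.norm_id_le
  obtain ⟨E₀, hE₀⟩ := exists_pvm_of_spectrum_subset hpos.isSelfAdjoint hspec
  have hid : IsBddMeas fun t : unitInterval => ((t : ℝ) : ℂ) :=
    isBddMeas_of_continuous (by fun_prop)
  have hs0 : MeasurableSet ({0} : Set unitInterval) := measurableSet_singleton 0
  have h0 : E₀.proj {0} = 0 := by
    have h1 : R * E₀.proj {0} = 0 := by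
      rw [← hE₀, ← E₀.bcalc_indicator hs0, ← E₀.bcalc_mul hid (.indicator_one hs0)]
      have h2 : (fun t : unitInterval => ((t : ℝ) : ℂ)) * ({0} : Set unitInterval).indicator 1 =
          (0 : ℂ) • 1 := by
        ext t
        by_cases ht : t = 0 <;> simp [ht]
      rw [h2, E₀.bcalc_smul 0 IsBddMeas.one, zero_smul]
    ext x
    exact hinj _ (congrArg (fun T : H →L[ℂ] H => T x) h1)
  let E := E₀.map measurable_resolventInv
  have hER : E.bcalc resolventFun = R := by
    obtain ⟨c, hc⟩ := isBddMeas_resolventFun.bdd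
    rw [ProjectionValuedMeasure.bcalc_map _ isBddMeas_resolventFun, ← hE₀]
    refine ProjectionValuedMeasure.bcalc_congr
      ⟨isBddMeas_resolventFun.measurable.comp measurable_resolventInv, c, fun a => hc _⟩ hid hs0 h0
      fun t ht => ?_
    have ht0 : (0 : ℝ) < t := lt_of_le_of_ne t.2.1 fun h => ht (Subtype.ext h.symm)
    have h1 : (resolventMap (resolventInv t) : ℝ) = t := by
      have : 1 ≤ 1 / (t : ℝ) := by
        rw [le_div_iff₀ ht0, one_mul]
        exact t.2.2
      simp only [resolventMap, resolventInv]
      rw [Real.coe_toNNReal _ (by linarith)]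
      field_simp
      ring
    simp only [Function.comp_apply, resolventFun, h1]
  have hE := E.isIntegral_integral measurable_coe_nnreal_complex
  refine ⟨E, ?_⟩
  have h1 : IsResolvent (E.integral fun t : ℝ≥0 => ((t : ℝ) : ℂ)) R := by
    rw [← hER]
    exact IsSpectralMeasure.isResolvent hE
  rw [hA.ext h1]
  exact hE

theorem isSpectralMeasure_adjoint_comp (hd : Dense (L.domain : Set H))
    (hc : L.IsClosed) : IsSpectralMeasure (compOp L.adjoint L)
      (spectralMeasure (compOp L.adjoint L)) := by
  obtain ⟨R, h1, h2, h3, h4⟩ := exists_isResolvent_adjoint_comp hd hc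
  obtain ⟨E, hE⟩ := exists_isSpectralMeasure_of_isResolvent h1 h2 h3 h4
  exact hE.spectralMeasure

/-! ### The modulus -/

theorem measurable_nnreal_sqrt : Measurable fun t : ℝ≥0 => NNReal.sqrt t :=
  NNReal.continuous_sqrt.measurable

/-- The spectral measure of `|L|` is the image of that of `L* L` under the square root. -/
theorem isSpectralMeasure_modulus (L : H →ₗ.[ℂ] H) :
    IsSpectralMeasure (modulus L)
      ((spectralMeasure (compOp L.adjoint L)).map measurable_nnreal_sqrt) := by
  rw [IsSpectralMeasure, ProjectionValuedMeasure.isIntegral_map_iff _ measurable_coe_nnreal_complex]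
  exact ProjectionValuedMeasure.isIntegral_integral _
    (measurable_coe_nnreal_complex.comp measurable_nnreal_sqrt)

theorem spectralProj_modulus {F : ProjectionValuedMeasure ℝ≥0 H}
    (hF : IsSpectralMeasure (compOp L.adjoint L) F) {s : Set ℝ≥0} (hs : MeasurableSet s) :
    spectralProj (modulus L) s = F.proj (NNReal.sqrt ⁻¹' s) := by
  rw [(isSpectralMeasure_modulus L).spectralProj_eq hs]
  exact hF.spectralMeasure.proj_eq hF (measurable_nnreal_sqrt hs)

variable {M : VonNeumannAlgebra H}

theorem IsAffiliated.adjoint_comp (hL : IsAffiliated M L) (hd : Dense (L.domain : Set H)) :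
    IsAffiliated M (compOp L.adjoint L) := by
  intro V hV x
  have hV' : ContinuousLinearMap.adjoint V ∈ M.commutant := by
    rw [← ContinuousLinearMap.star_eq_adjoint]
    exact star_mem hV
  obtain ⟨hx, hx'⟩ := mem_compOp_domain.1 x.2
  obtain ⟨h1, h2⟩ := hL V hV ⟨x, hx⟩
  have h3 : ∀ u : L.domain, ⟪V (L.adjoint ⟨L ⟨x, hx⟩, hx'⟩), (u : H)⟫_ℂ =
      ⟪L ⟨V x, h1⟩, L u⟫_ℂ := by
    intro u
    obtain ⟨h4, h5⟩ := hL _ hV' u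
    rw [h2, ← ContinuousLinearMap.adjoint_inner_right,
      ← ContinuousLinearMap.adjoint_inner_right V, ← h5]
    exact LinearPMap.adjoint_isFormalAdjoint hd ⟨L ⟨x, hx⟩, hx'⟩ ⟨_, h4⟩
  have h6 := LinearPMap.mem_adjoint_domain_of_exists _ ⟨_, h3⟩
  exact ⟨mem_compOp_domain.2 ⟨h1, h6⟩, LinearPMap.adjoint_apply_eq hd ⟨_, h6⟩ h3⟩

/-- If `L` is affiliated with `M`, then the commutant of `M` commutes with the spectral projections
of `|L|`. -/
theorem IsAffiliated.spectralProj_modulus_commute (hL : IsAffiliated M L)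
    (hd : Dense (L.domain : Set H)) (hc : L.IsClosed) {V : H →L[ℂ] H} (hV : V ∈ M.commutant)
    {s : Set ℝ≥0} (hs : MeasurableSet s) :
    V * spectralProj (modulus L) s = spectralProj (modulus L) s * V := by
  have hF := isSpectralMeasure_adjoint_comp hd hc
  rw [spectralProj_modulus hF hs]
  exact hF.intertwine hF (hL.adjoint_comp hd V hV) (measurable_nnreal_sqrt hs)

/-- The spectral projection of `|L|` at `0` has its range in the domain of `L* L` and is annihilated
by `L* L`, hence by `L`; so it vanishes when `L` is injective. -/
theorem spectralProj_modulus_singleton_zero (hd : Dense (L.domain : Set H)) (hc : L.IsClosed)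
    (hker : ∀ x : L.domain, L x = 0 → (x : H) = 0) : spectralProj (modulus L) {0} = 0 := by
  have hF := isSpectralMeasure_adjoint_comp hd hc
  have hs0 : MeasurableSet ({0} : Set ℝ≥0) := measurableSet_singleton 0
  have hpre : NNReal.sqrt ⁻¹' ({0} : Set ℝ≥0) = {0} := by
    ext t
    simp
  rw [spectralProj_modulus hF hs0, hpre]
  set F := spectralMeasure (compOp L.adjoint L)
  have h2 : (fun t : ℝ≥0 => ((t : ℝ) : ℂ)) * ({0} : Set ℝ≥0).indicator 1 = (0 : ℂ) • 1 := by
    ext t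
    by_cases ht : t = 0 <;> simp [ht]
  ext y
  obtain ⟨h, h'⟩ := ProjectionValuedMeasure.IsIntegral.apply_bcalc measurable_coe_nnreal_complex
    hF (.indicator_one hs0) (by rw [h2]; exact IsBddMeas.one.smul 0) y
  rw [h2, F.bcalc_smul 0 IsBddMeas.one, zero_smul] at h'
  obtain ⟨h3, h4⟩ := mem_compOp_domain.1 h
  rw [compOp_apply h h3 h4] at h'
  have h5 := LinearPMap.adjoint_isFormalAdjoint hd ⟨_, h4⟩ ⟨_, h3⟩
  rw [h', _root_.zero_apply, inner_zero_left] at h5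
  have h6 := hker ⟨_, h3⟩ (inner_self_eq_zero.1 h5.symm)
  rw [← F.bcalc_indicator hs0]
  exact h6

end

/-! ### Bounded functions of the modulus -/

section

variable {H : Type*} [NormedAddCommGroup H] [InnerProductSpace ℂ H] [CompleteSpace H]

theorem borelCalc_eq_toPMap (A : H →ₗ.[ℂ] H) {φ : ℝ≥0 → ℂ} (hφ : IsBddMeas φ) :
    borelCalc A φ = ((spectralMeasure A).bcalc φ : H →ₗ[ℂ] H).toPMap ⊤ :=
  ((spectralMeasure A).isIntegral_of_bdd hφ).integral_eq hφ.measurable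

omit [CompleteSpace H] in
theorem compOp_toPMap_top (S T : H →L[ℂ] H) :
    compOp ((S : H →ₗ[ℂ] H).toPMap ⊤) ((T : H →ₗ[ℂ] H).toPMap ⊤) =
      ((S * T : H →L[ℂ] H) : H →ₗ[ℂ] H).toPMap ⊤ := by
  refine LinearPMap.ext (Submodule.ext fun x => ?_) fun x h1 h2 => ?_
  · rw [mem_compOp_domain]
    exact ⟨fun _ => Submodule.mem_top, fun _ => ⟨Submodule.mem_top, Submodule.mem_top⟩⟩
  · exact compOp_apply h1 Submodule.mem_top Submodule.mem_top

/-- For bounded `φ`, the spectral measure of `|φ(A)|` is the image under `|φ|` of that of `A`. -/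
theorem spectralProj_modulus_borelCalc (A : H →ₗ.[ℂ] H) {φ : ℝ≥0 → ℂ} (hφ : IsBddMeas φ)
    {s : Set ℝ≥0} (hs : MeasurableSet s) :
    spectralProj (modulus (borelCalc A φ)) s = spectralProj A {v | ‖φ v‖₊ ∈ s} := by
  set E := spectralMeasure A with hE
  have hk : Measurable fun v => ‖φ v‖₊ ^ 2 := hφ.measurable.nnnorm.pow_const 2
  have hdense : Dense ((⊤ : Submodule ℂ H) : Set H) := by simp
  have hbdd : IsBddMeas (star φ * φ) := hφ.star.mul hφ
  have hfun : (fun t : ℝ≥0 => ((t : ℝ) : ℂ)) ∘ (fun v => ‖φ v‖₊ ^ 2) = star φ * φ := by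
    ext v
    simp only [Function.comp_apply, Pi.mul_apply, Pi.star_apply, NNReal.coe_pow, coe_nnnorm,
      Complex.star_def]
    rw [← Complex.normSq_eq_conj_mul_self, Complex.normSq_eq_norm_sq]
  have hF : IsSpectralMeasure (compOp (borelCalc A φ).adjoint (borelCalc A φ)) (E.map hk) := by
    rw [borelCalc_eq_toPMap A hφ,
      ContinuousLinearMap.toPMap_adjoint_eq_adjoint_toPMap_of_dense _ hdense,
      compOp_toPMap_top, ← ContinuousLinearMap.star_eq_adjoint, ← hE, ← E.bcalc_star hφ,
      ← E.bcalc_mul hφ.star hφ, IsSpectralMeasure,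
      ProjectionValuedMeasure.isIntegral_map_iff hk measurable_coe_nnreal_complex, hfun]
    exact E.isIntegral_of_bdd hbdd
  rw [spectralProj_modulus hF hs]
  change E.proj _ = E.proj _
  congr 1
  ext v
  simp

/-! ### Traces and weak Lorentz norms -/

variable {M : VonNeumannAlgebra H}

theorem Trace.map_zero (τ : Trace M) : τ.toFun 0 = 0 := by
  have := τ.map_smul 0 0 (zero_mem M) ContinuousLinearMap.isPositive_zero
  simpa using this

/-- The trace is monotone along a projection-valued measure with values in `M`, by additivity. -/
theorem Trace.proj_mono (τ : Trace M) {α : Type*} [MeasurableSpace α]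
    {E : ProjectionValuedMeasure α H} (hM : ∀ s, MeasurableSet s → E.proj s ∈ M)
    {s t : Set α} (hs : MeasurableSet s) (ht : MeasurableSet t) (hst : s ⊆ t) :
    τ.toFun (E.proj s) ≤ τ.toFun (E.proj t) := by
  have hp : ∀ s, MeasurableSet s → (E.proj s).IsPositive := fun s hs =>
    ContinuousLinearMap.IsPositive.of_isStarProjection (E.isStarProjection_proj s hs)
  have hd := ht.diff hs
  have h : t = s ∪ t \ s := (Set.union_sdiff_cancel hst).symm
  rw [h, E.proj_union hs hd Set.disjoint_sdiff_right,
    τ.map_add _ (hM s hs) _ (hM _ hd) (hp s hs) (hp _ hd)]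
  exact le_self_add

/-- `‖T‖_{r,∞} ≤ sup_v ψ(v) m(v)^{1/r}` as soon as every `γ > 0` with `d_γ(T) ≠ 0` is of the form
`γ = ψ(v)` with `d_γ(T) ≤ m(v)`. -/
theorem Trace.weakLorentzNorm_le (τ : Trace M) {r : ℝ} (hr : 1 ≤ r) {T : H →ₗ.[ℂ] H}
    {ψ : ℝ≥0 → ℝ} {m : ℝ≥0 → ℝ≥0∞}
    (h : ∀ γ : ℝ≥0, 0 < γ → τ.distribution T γ ≠ 0 →
      ∃ v : ℝ≥0, 0 < v ∧ ψ v = γ ∧ τ.distribution T γ ≤ m v) :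
    τ.weakLorentzNorm r T ≤ ⨆ (v : ℝ≥0) (_ : 0 < v), ENNReal.ofReal (ψ v) * m v ^ (1 / r) := by
  refine iSup₂_le fun t ht => ENNReal.mul_le_of_forall_lt fun a ha b hb => ?_
  lift b to ℝ≥0 using (hb.trans_le le_top).ne
  have hdist : (t : ℝ≥0∞) < τ.distribution T b := by
    -- a level `b < μ_t` is not yet admissible in the infimum that defines `μ_t`
    by_contra! hle
    exact hb.not_ge (iInf₂_le b hle)
  rcases eq_or_lt_of_le (zero_le : 0 ≤ b) with rfl | hb0
  · simp
  obtain ⟨v, hv, hψ, hm⟩ := h b hb0 (ne_bot_of_gt hdist)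
  refine le_trans ?_ (le_iSup₂ (f := fun (v : ℝ≥0) (_ : 0 < v) =>
    ENNReal.ofReal (ψ v) * m v ^ (1 / r)) v hv)
  rw [hψ, ENNReal.ofReal_coe_nnreal, mul_comm]
  gcongr
  exact ha.le.trans (ENNReal.rpow_le_rpow (hdist.le.trans hm) (by positivity))

/-- The superlevel set at `γ` of a continuous decreasing `ψ` vanishing at infinity is contained in
`[0, v)` for some `v` with `ψ v = γ`. -/
theorem exists_superlevel_eq {ψ : ℝ≥0 → ℝ} (hc : Continuous ψ) (ha : Antitone ψ)
    (hlim : Tendsto ψ atTop (𝓝 0)) {γ : ℝ} (hγ : 0 < γ) (hγ0 : γ < ψ 0) :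
    ∃ v : ℝ≥0, 0 < v ∧ ψ v = γ ∧ ∀ w, γ < ψ w → w < v := by
  obtain ⟨b, hb⟩ := (hlim.eventually_lt_const hγ).exists
  have h0b : (0 : ℝ≥0) ≤ b := zero_le
  obtain ⟨v, -, hv⟩ := intermediate_value_Icc' h0b hc.continuousOn ⟨hb.le, hγ0.le⟩
  refine ⟨v, pos_iff_ne_zero.2 ?_, hv, fun w hw => ?_⟩
  · rintro rfl
    exact hγ0.ne' hv
  · by_contra! hle
    exact (hw.trans_le (ha hle)).ne' hv

end

end NCLorentz

end

theorem mainTheorem1 {H : Type*} [NormedAddCommGroup H] [InnerProductSpace ℂ H] [CompleteSpace H]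
    (M : VonNeumannAlgebra H) (τ : NCLorentz.Trace M) (hτ : τ.IsSemifinite)
    (L : H →ₗ.[ℂ] H) (hL_dense : Dense (L.domain : Set H)) (hL_closed : L.IsClosed)
    (hL_aff : NCLorentz.IsAffiliated M L)
    (φ : ℝ≥0 → ℂ) (hφ : Measurable φ)
    (ψ : ℝ≥0 → ℝ) (hψ_cont : Continuous ψ) (hψ_anti : Antitone ψ) (hψ_zero : ψ 0 = 1)
    (hψ_lim : Tendsto ψ atTop (𝓝 0))
    (hφψ : ∀ v, ‖φ v‖ ≤ ψ v)
    (r : ℝ) (hr : 1 ≤ r) :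
    τ.IsMeasurableOp (NCLorentz.borelCalc (NCLorentz.modulus L) φ) ∧
    τ.weakLorentzNorm r (NCLorentz.borelCalc (NCLorentz.modulus L) φ) ≤
      ⨆ (v : ℝ≥0) (_ : 0 < v), ENNReal.ofReal (ψ v) *
        τ.toFun (NCLorentz.spectralProj (NCLorentz.modulus L) (Set.Ico 0 v)) ^ (1 / r) ∧
    ((∀ x : L.domain, L x = 0 → (x : H) = 0) ∨ φ 0 = 0 →
      τ.weakLorentzNorm r (NCLorentz.borelCalc (NCLorentz.modulus L) φ) ≤
        ⨆ (v : ℝ≥0) (_ : 0 < v), ENNReal.ofReal (ψ v) *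
          τ.toFun (NCLorentz.spectralProj (NCLorentz.modulus L) (Set.Ioo 0 v)) ^ (1 / r)) := by
  open NCLorentz in
  have hbdd : IsBddMeas φ := ⟨hφ, 1, fun v =>
    (hφψ v).trans (hψ_zero ▸ hψ_anti (zero_le : 0 ≤ v))⟩
  have hcomm : ∀ V ∈ M.commutant, ∀ s, MeasurableSet s →
      V * (spectralMeasure (modulus L)).proj s = (spectralMeasure (modulus L)).proj s * V :=
    fun V hV s hs => hL_aff.spectralProj_modulus_commute hL_dense hL_closed hV hs
  have hM : ∀ s, MeasurableSet s → (spectralMeasure (modulus L)).proj s ∈ M := fun s hs => by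
    rw [← M.commutant_commutant, VonNeumannAlgebra.mem_commutant_iff]
    exact fun V hV => hcomm V hV s hs
  have hdist : ∀ γ : ℝ≥0, τ.distribution (borelCalc (modulus L) φ) γ =
      τ.toFun ((spectralMeasure (modulus L)).proj {v | γ < ‖φ v‖₊}) := fun γ =>
    congrArg τ.toFun (spectralProj_modulus_borelCalc _ hbdd measurableSet_Ioi)
  have hlevel : ∀ γ : ℝ≥0, MeasurableSet {v | γ < ‖φ v‖₊} := fun γ =>
    measurableSet_lt measurable_const hφ.nnnorm
  have hsuper : ∀ γ : ℝ≥0, 0 < γ → τ.distribution (borelCalc (modulus L) φ) γ ≠ 0 →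
      ∃ v : ℝ≥0, 0 < v ∧ ψ v = γ ∧ ∀ w, γ < ‖φ w‖₊ → w < v := by
    intro γ hγ hne
    have hφψ' : ∀ w, γ < ‖φ w‖₊ → (γ : ℝ) < ψ w := fun w hw =>
      lt_of_lt_of_le (NNReal.coe_lt_coe.2 hw) (hφψ w)
    -- for `γ ≥ 1 = ψ 0` the superlevel set is empty and the distribution function vanishes
    have hγ0 : (γ : ℝ) < ψ 0 := by
      by_contra! hle
      have hempty : {v | γ < ‖φ v‖₊} = ∅ := Set.eq_empty_of_forall_notMem fun w hw =>
        ((hφψ' w hw).trans_le (hψ_anti (zero_le : 0 ≤ w))).not_ge hle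
      refine hne ?_
      rw [hdist, hempty, show (spectralMeasure (modulus L)).proj ∅ = 0 from
        ContinuousLinearMap.ext fun x => ProjectionValuedMeasure.proj_empty _ x, τ.map_zero]
    obtain ⟨v, hv, hvγ, hlt⟩ := exists_superlevel_eq hψ_cont hψ_anti hψ_lim
      (NNReal.coe_pos.2 hγ) hγ0
    exact ⟨v, hv, hvγ, fun w hw => hlt w (hφψ' w hw)⟩
  refine ⟨?_, ?_, fun hker => ?_⟩
  · -- `φ(|L|)` is bounded, so that the projection `1` serves for every `ε`
    have hT := borelCalc_eq_toPMap (modulus L) hbdd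
    set Φ := (spectralMeasure (modulus L)).bcalc φ
    rw [hT]
    refine ⟨?_, by simp [LinearMap.toPMap], fun V hV x => ⟨Submodule.mem_top, ?_⟩,
      fun ε _ => ⟨1, one_mem M, IsStarProjection.one _, fun x => Submodule.mem_top, ?_⟩⟩
    · have hg : (((Φ : H →ₗ[ℂ] H).toPMap ⊤).graph : Set (H × H)) = {p | Φ p.1 = p.2} := by
        ext p
        simp only [SetLike.mem_coe, LinearPMap.mem_graph_iff]
        exact ⟨fun ⟨_, h1, h2⟩ => (congrArg Φ h1).symm.trans h2,
          fun h => ⟨⟨p.1, Submodule.mem_top⟩, rfl, h⟩⟩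
      rw [LinearPMap.IsClosed, hg]
      exact isClosed_eq (Φ.continuous.comp continuous_fst) continuous_snd
    · have := ProjectionValuedMeasure.bcalc_intertwine _ (hcomm V hV) hbdd
      exact congrArg (fun S : H →L[ℂ] H => S x) this.symm
    · rw [sub_self, τ.map_zero]
      exact zero_le
  · refine τ.weakLorentzNorm_le hr fun γ hγ hne => ?_
    obtain ⟨v, hv, hvγ, hlt⟩ := hsuper γ hγ hne
    refine ⟨v, hv, hvγ, ?_⟩
    rw [hdist]
    exact τ.proj_mono hM (hlevel γ) measurableSet_Ico fun w hw => ⟨zero_le, hlt w hw⟩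
  · refine τ.weakLorentzNorm_le hr fun γ hγ hne => ?_
    obtain ⟨v, hv, hvγ, hlt⟩ := hsuper γ hγ hne
    refine ⟨v, hv, hvγ, ?_⟩
    rw [hdist]
    rcases hker with hker | h0
    · -- the point `0` has spectral measure zero and may be dropped from `[0, v)`
      have h0 : (spectralMeasure (modulus L)).proj {0} = 0 :=
        spectralProj_modulus_singleton_zero hL_dense hL_closed hker
      have hico : (spectralMeasure (modulus L)).proj (Set.Ico 0 v) =
          (spectralMeasure (modulus L)).proj (Set.Ioo 0 v) := by
        rw [← Set.Ioo_union_left hv, ProjectionValuedMeasure.proj_union _ measurableSet_Ioo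
          (measurableSet_singleton 0) (by simp), h0, add_zero]
      refine le_of_le_of_eq ?_ (congrArg τ.toFun hico)
      exact τ.proj_mono hM (hlevel γ) measurableSet_Ico fun w hw => ⟨zero_le, hlt w hw⟩
    · refine τ.proj_mono hM (hlevel γ) measurableSet_Ioo fun w hw => ⟨?_, hlt w hw⟩
      refine pos_iff_ne_zero.2 ?_
      rintro rfl
      simp [h0] at hw
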